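/- Let $n\ge 2$, let $C_{\mathrm{sig}}\in\mathbb R^{n\times n}$ be symmetric, write $\mathrm{tf}(X)=X-\frac{\mathrm{tr}X}{n}I$, $C_e=\mathrm{tf}(C_{\mathrm{sig}})$, and for $M\in SO(n)$ put $A(M)=M^\top C_eM$, $f(M)=\frac12\|A(M)-\operatorname{diag}A(M)\|_F^2$, and, for symmetric $C$, $\Omega_C(M)=[M^\top CM,\operatorname{diag}(M^\top CM)]$. For $\delta>0$ let $\mathcal N_\delta=\{M\in SO(n): |A(M)_{ii}-A(M)_{jj}|\ge\delta \text{ for all } i\ne j\}$. Let $c_n=2\sqrt n+8$ and $L_C=c_n\|C_e\|_2^2$. On a probability space with a filtration $(\mathcal F_k)$ let $C_k=C_{\mathrm{sig}}+\sigma_k^2I+E_k$, where $(\sigma_k)$ is an arbitrary (possibly random and unbounded) real sequence and the $E_k$ are random symmetric matrices, $E_k$ being $\mathcal F_{k+1}$-measurable. Consider the iteration, started at a deterministic $M_0$, $$M_{k+1}=M_k\,\mathrm{Cay}(\eta_k\Omega_{C_k}(M_k)),\qquad \mathrm{Cay}(X)=(I-\tfrac12X)^{-1}(I+\tfrac12X),\qquad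 \eta_k=\frac{c}{k+k_0},$$ with $c>\frac1{2\delta^2}$, $k_0>0$ and $\eta_0<1/L_C$. Let $U_k=\Omega_{C_k}(M_k)-\Omega_{C_{\mathrm{sig}}}(M_k)$ and $E_{e,k}=\mathrm{tf}(E_k)$. Assume that almost surely $M_k\in\mathcal N_\delta$ for all $k$, that $U_k$ is square integrable, and that $\mathbb E[U_k\mid\mathcal F_k]=0$ and $\mathbb E[\|U_k\|_F^2\mid\mathcal F_k]\le\sigma_u^2$. For $\varepsilon>0$ let $k^\ast(\varepsilon)$ be the least $N$ such that $\mathbb E f(M_k)\le\varepsilon$ for all $k\ge N$. Then: 1. $\mathbb E[f(M_k)]\le \dfrac{C}{k+k_0}$ for all $k\ge0$, with $C=\max\Big\{2k_0f(M_0),\ \dfrac{c^2L_C\sigma_u^2}{2c\delta^2-1}\Big\}$. If moreover $\eta_0L_C\le 2-\frac1{c\delta^2}$ (which is automatic when $c\ge1/\delta^2$), the same holds with $C=\max\Big\{k_0f(M_0),\ \dfrac{c^2L_C\sigma_u^2}{2c\delta^2-1}\Big\}$. 2. $k^\ast(\varepsilon)\le\lceil C/\varepsilon\rceil$ for every $\varepsilon>0$,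 with the first constant $C$ of part 1. If $\sigma_u>0$, then for all sufficiently small $\varepsilon>0$ $$k^\ast(\varepsilon)\le\Big\lceil \kappa\,\frac{L_C\sigma_u^2}{\delta^2\varepsilon}\Big\rceil,\qquad \kappa=c\cdot\frac{c\delta^2}{2c\delta^2-1}.$$ 3. If $v>0$ and $r$ are such that $\mathbb E[\|E_{e,k}\|_F^2\mid\mathcal F_k]\le v$ and $\mathbb E[\|E_{e,k}\|_F^4\mid\mathcal F_k]\le r^2v<\infty$ for all $k$ (for instance: noise independent of $\mathcal F_k$ with $\mathbb E\|E_{e,k}\|_F^2=v$ and $\|E_{e,k}\|_F\le r$), then for all sufficiently small $\varepsilon>0$ $$k^\ast(\varepsilon)\le\Big\lceil K\,\frac{\|C_e\|_2^2\,v}{\delta^2\varepsilon}\Big\rceil,\qquad K=c_n\,\kappa\,\big(32\|C_e\|_2^2+8r^2\big).$$ 4. None of this depends on $(\sigma_k)$: replacing it by any other sequence leaves every $M_k$ unchanged. -/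

import Mathlib

open MeasureTheory

namespace CayleyFlow

noncomputable section

/-- Squared Frobenius norm `‖X‖_F²`. -/
def frobSq {n : ℕ} (X : Matrix (Fin n) (Fin n) ℝ) : ℝ := ∑ i, ∑ j, X i j ^ 2

/-- Spectral norm `‖X‖₂`: the operator norm of `X` on Euclidean space. -/
def specNorm {n : ℕ} (X : Matrix (Fin n) (Fin n) ℝ) : ℝ :=
  ‖Matrix.toEuclideanCLM (n := Fin n) (𝕜 := ℝ) X‖

/-- Trace-free part `tf(X) = X - (tr X / n) I`. -/
def tf {n : ℕ} (X : Matrix (Fin n) (Fin n) ℝ) : Matrix (Fin n) (Fin n) ℝ :=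
  X - (X.trace / (n : ℝ)) • (1 : Matrix (Fin n) (Fin n) ℝ)

/-- `Mᵀ C M`. -/
def rotated {n : ℕ} (C M : Matrix (Fin n) (Fin n) ℝ) : Matrix (Fin n) (Fin n) ℝ :=
  M.transpose * C * M

/-- Diagonal part of a matrix. -/
def diagPart {n : ℕ} (A : Matrix (Fin n) (Fin n) ℝ) : Matrix (Fin n) (Fin n) ℝ :=
  Matrix.diagonal A.diag

/-- Diagonalization objective `f(M) = ½ ‖off(Mᵀ C_e M)‖_F²` with `C_e = tf(C_sig)`. -/
def objective {n : ℕ} (Csig M : Matrix (Fin n) (Fin n) ℝ) : ℝ :=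
  (1 / 2) * frobSq (rotated (tf Csig) M - diagPart (rotated (tf Csig) M))

/-- Commutator generator `Ω_C(M) = [A, diag A]` with `A = Mᵀ C M`. -/
def generator {n : ℕ} (C M : Matrix (Fin n) (Fin n) ℝ) : Matrix (Fin n) (Fin n) ℝ :=
  rotated C M * diagPart (rotated C M) - diagPart (rotated C M) * rotated C M

/-- Cayley map `(I - X/2)⁻¹ (I + X/2)`. -/
def cay {n : ℕ} (X : Matrix (Fin n) (Fin n) ℝ) : Matrix (Fin n) (Fin n) ℝ :=
  (1 - (1 / 2 : ℝ) • X)⁻¹ * (1 + (1 / 2 : ℝ) • X)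

/-- The spectral separation domain: the `M ∈ SO(n)` such that any two diagonal entries of
`Mᵀ C_e M` are at distance at least `δ`. -/
def separated {n : ℕ} (Csig : Matrix (Fin n) (Fin n) ℝ) (δ : ℝ) :
    Set (Matrix (Fin n) (Fin n) ℝ) :=
  {M | M ∈ Matrix.specialOrthogonalGroup (Fin n) ℝ ∧
    ∀ i j, i ≠ j → δ ≤ |rotated (tf Csig) M i i - rotated (tf Csig) M j j|}

/-- Step sizes `η_k = c / (k + k₀)`. -/
def step (c k₀ : ℝ) (k : ℕ) : ℝ := c / ((k : ℝ) + k₀)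

/-- Cayley iteration `M_{k+1} = M_k Cay(η_k Ω_{C_k}(M_k))` driven by matrices `C_k`. -/
def iterate {n : ℕ} (η : ℕ → ℝ) (C : ℕ → Matrix (Fin n) (Fin n) ℝ)
    (M₀ : Matrix (Fin n) (Fin n) ℝ) : ℕ → Matrix (Fin n) (Fin n) ℝ
  | 0 => M₀
  | k + 1 => iterate η C M₀ k * cay (η k • generator (C k) (iterate η C M₀ k))

/-- Observations `C_k = C_sig + σ_k² I + E_k`. -/
def observed {n : ℕ} {Ω : Type*} (Csig : Matrix (Fin n) (Fin n) ℝ) (σ : ℕ → Ω → ℝ)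
    (E : ℕ → Ω → Matrix (Fin n) (Fin n) ℝ) (k : ℕ) (ω : Ω) : Matrix (Fin n) (Fin n) ℝ :=
  Csig + (σ k ω) ^ 2 • (1 : Matrix (Fin n) (Fin n) ℝ) + E k ω

/-- The random iterate `M_k`. -/
def traj {n : ℕ} {Ω : Type*} (Csig : Matrix (Fin n) (Fin n) ℝ) (σ : ℕ → Ω → ℝ)
    (E : ℕ → Ω → Matrix (Fin n) (Fin n) ℝ) (η : ℕ → ℝ) (M₀ : Matrix (Fin n) (Fin n) ℝ)
    (k : ℕ) (ω : Ω) : Matrix (Fin n) (Fin n) ℝ :=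
  iterate η (fun j => observed Csig σ E j ω) M₀ k

/-- The effective input `U_k = Ω_{C_k}(M_k) - Ω_{C_sig}(M_k)`. -/
def input {n : ℕ} {Ω : Type*} (Csig : Matrix (Fin n) (Fin n) ℝ) (σ : ℕ → Ω → ℝ)
    (E : ℕ → Ω → Matrix (Fin n) (Fin n) ℝ) (η : ℕ → ℝ) (M₀ : Matrix (Fin n) (Fin n) ℝ)
    (k : ℕ) (ω : Ω) : Matrix (Fin n) (Fin n) ℝ :=
  generator (observed Csig σ E k ω) (traj Csig σ E η M₀ k ω)
    - generator Csig (traj Csig σ E η M₀ k ω)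

/-- `c_n = 2 √n + 8`. -/
def dimConst (n : ℕ) : ℝ := 2 * Real.sqrt n + 8

/-- `L_C = c_n ‖C_e‖₂²`. -/
def lipConst {n : ℕ} (Csig : Matrix (Fin n) (Fin n) ℝ) : ℝ :=
  dimConst n * specNorm (tf Csig) ^ 2

/-- Expected objective value `𝔼 f(M_k)`. -/
def meanObj {n : ℕ} {Ω : Type*} [MeasurableSpace Ω] (μ : Measure Ω)
    (Csig : Matrix (Fin n) (Fin n) ℝ) (σ : ℕ → Ω → ℝ)
    (E : ℕ → Ω → Matrix (Fin n) (Fin n) ℝ) (η : ℕ → ℝ) (M₀ : Matrix (Fin n) (Fin n) ℝ)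
    (k : ℕ) : ℝ :=
  ∫ ω, objective Csig (traj Csig σ E η M₀ k ω) ∂μ

/-- `k*(ε)`: the least `N` with `F k ≤ ε` for all `k ≥ N` (infinite if there is none). -/
def sampleCount (F : ℕ → ℝ) (ε : ℝ) : ℕ∞ :=
  sInf {N : ℕ∞ | ∀ k : ℕ, N ≤ (k : ℕ∞) → F k ≤ ε}

/-- The noise term `c² L_C s / (2 c δ² - 1)` of the rate constant, for an input variance `s`. -/
def noiseConst {n : ℕ} (Csig : Matrix (Fin n) (Fin n) ℝ) (δ c s : ℝ) : ℝ :=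
  c ^ 2 * lipConst Csig * s / (2 * c * δ ^ 2 - 1)

/-- The factor `c · cδ² / (2cδ² - 1)`, which lies between `c / 2` and `c` once `cδ² ≥ 1`. -/
def stepFactor (δ c : ℝ) : ℝ := c * (c * δ ^ 2 / (2 * c * δ ^ 2 - 1))

end

end CayleyFlow

namespace CayleyFlow

/-! Let `A = Mᵀ C_e M`. Orthogonal conjugation preserves `‖A‖_F`, so lowering `f` means raising `½ ∑
A_ii²`. This is convex in `A`, so its first-order change already bounds the decrease of `f`. The
Cayley step has the exact form `Qᵀ A Q - A = Zᵀ (A X - X A) Z`, where `Z = (1 - X/2)⁻¹` is a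
contraction because `X` is skew. Hence `f(M Q) ≤ f(M) - ⟨Ω, X⟩ + 2 ‖C_e‖₂² ‖X‖_F²`
(`objective_mul_cay_le`). Since `Ω_ij = A_ij (A_jj - A_ii)`, separation gives `‖Ω‖_F² ≥ 2 δ² f`
(`two_mul_objective_le`).

For `X = η (Ω + U)`, conditional centring removes `⟨Ω, U⟩` in mean (`integral_frobInner_eq_zero`).
With `κ = k + k₀`, `β = 2cδ² > 1`, `ℓ = c L_C < k₀` and `N` the noise constant, `a_k = 𝔼 f(M_k)`
satisfies `a_{k+1} ≤ (1 - β (1 - ℓ/(4κ)) / κ) a_k + (β - 1) N / (4κ²)` (`meanObj_succ_le`).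

For `β` near `1` the loss `ℓ/(4κ)` can break an induction on `C/κ`. The induction therefore runs on
`C/κ · (1 - ℓ/(2κ))`; its last factor is at least `1/2` at the start, whence the `2` in `2 k₀ f(M₀)`
(`rate_step`). Once `ℓ/κ ≤ 2 - 2/β`, plain `C/κ` is preserved (`rate_step_of_le`). For small `ε` the
initial value drops out (`eventually_rate`): if `κ a_k` stayed above `N`, it would lose a multiple
of the divergent harmonic series.

The background `σ_k² I` cancels in the commutator when `M` is orthogonal, so the iterates do not see
it and are adapted even though `σ` need not be measurable. -/

/-- Frobenius inner product. -/
noncomputable def frobInner {n : ℕ} (X Y : Matrix (Fin n) (Fin n) ℝ) : ℝ :=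
  ∑ i, ∑ j, X i j * Y i j

/-! ### Frobenius norm and inner product -/

section Frobenius

variable {n : ℕ} (X Y : Matrix (Fin n) (Fin n) ℝ)

theorem frobSq_nonneg : 0 ≤ frobSq X :=
  Finset.sum_nonneg fun _ _ => Finset.sum_nonneg fun _ _ => sq_nonneg _

theorem frobInner_eq_trace : frobInner X Y = (X.transpose * Y).trace := by
  simp only [frobInner, Matrix.trace, Matrix.diag, Matrix.mul_apply, Matrix.transpose_apply]
  exact Finset.sum_comm

theorem frobSq_eq_frobInner : frobSq X = frobInner X X := by
  simp only [frobSq, frobInner, sq]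

theorem frobSq_eq_trace : frobSq X = (X.transpose * X).trace := by
  rw [frobSq_eq_frobInner, frobInner_eq_trace]

theorem frobSq_transpose : frobSq X.transpose = frobSq X := by
  simp only [frobSq, Matrix.transpose_apply]
  exact Finset.sum_comm

theorem frobSq_smul (a : ℝ) : frobSq (a • X) = a ^ 2 * frobSq X := by
  simp only [frobSq, Matrix.smul_apply, smul_eq_mul, mul_pow, Finset.mul_sum]

theorem frobInner_smul_right (a : ℝ) : frobInner X (a • Y) = a * frobInner X Y := by
  simp only [frobInner, Matrix.smul_apply, smul_eq_mul, Finset.mul_sum]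
  refine Finset.sum_congr rfl fun i _ => Finset.sum_congr rfl fun j _ => by ring

theorem frobInner_add_right (Z : Matrix (Fin n) (Fin n) ℝ) :
    frobInner X (Y + Z) = frobInner X Y + frobInner X Z := by
  simp only [frobInner, Matrix.add_apply, mul_add, Finset.sum_add_distrib]

theorem frobSq_add : frobSq (X + Y) = frobSq X + 2 * frobInner X Y + frobSq Y := by
  simp only [frobSq, frobInner, Matrix.add_apply, Finset.mul_sum, ← Finset.sum_add_distrib]
  refine Finset.sum_congr rfl fun i _ => Finset.sum_congr rfl fun j _ => by ring

theorem frobSq_sub : frobSq (X - Y) = frobSq X - 2 * frobInner X Y + frobSq Y := by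
  simp only [frobSq, frobInner, Matrix.sub_apply, Finset.mul_sum, ← Finset.sum_add_distrib,
    ← Finset.sum_sub_distrib]
  refine Finset.sum_congr rfl fun i _ => Finset.sum_congr rfl fun j _ => by ring

theorem frobSq_add_le : frobSq (X + Y) ≤ 2 * frobSq X + 2 * frobSq Y := by
  have h1 := frobSq_nonneg (X - Y)
  rw [frobSq_sub] at h1
  rw [frobSq_add]
  linarith

theorem frobSq_sub_le : frobSq (X - Y) ≤ 2 * frobSq X + 2 * frobSq Y := by
  have h1 := frobSq_nonneg (X + Y)
  rw [frobSq_add] at h1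
  rw [frobSq_sub]
  linarith

theorem frobInner_le_four_mul_add : frobInner X Y ≤ 4 * frobSq X + 1 / 16 * frobSq Y := by
  simp only [frobSq, frobInner, Finset.mul_sum, ← Finset.sum_add_distrib]
  refine Finset.sum_le_sum fun i _ => Finset.sum_le_sum fun j _ => ?_
  nlinarith [sq_nonneg (2 * X i j - 1 / 4 * Y i j)]

theorem sq_apply_le_frobSq (i j : Fin n) : X i j ^ 2 ≤ frobSq X := by
  have h : ∑ j, X i j ^ 2 ≤ frobSq X :=
    Finset.single_le_sum (f := fun i => ∑ j, X i j ^ 2)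
      (fun i _ => Finset.sum_nonneg fun j _ => sq_nonneg (X i j)) (Finset.mem_univ i)
  refine le_trans ?_ h
  exact Finset.single_le_sum (f := fun j => X i j ^ 2) (fun j _ => sq_nonneg (X i j))
    (Finset.mem_univ j)

/-- The operator norm bound on Euclidean space, applied to each column of `X`; the transposes turn
columns into the outer sum. -/
theorem frobSq_mul_le_specNorm (A : Matrix (Fin n) (Fin n) ℝ) :
    frobSq (A * X) ≤ specNorm A ^ 2 * frobSq X := by
  rw [← frobSq_transpose, ← frobSq_transpose X]
  rw [frobSq, frobSq, Finset.mul_sum]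
  refine Finset.sum_le_sum fun j _ => ?_
  have h := (Matrix.toEuclideanCLM (n := Fin n) (𝕜 := ℝ) A).le_opNorm
    (WithLp.toLp 2 fun i => X i j)
  have h2 := pow_le_pow_left₀ (norm_nonneg _) h 2
  rw [mul_pow, EuclideanSpace.norm_sq_eq, EuclideanSpace.norm_sq_eq] at h2
  simpa [specNorm, Matrix.mul_apply, Matrix.mulVec, dotProduct] using h2

theorem frobSq_orthogonal_mul {M : Matrix (Fin n) (Fin n) ℝ} (hM : M.transpose * M = 1) :
    frobSq (M * X) = frobSq X := by
  rw [frobSq_eq_trace, frobSq_eq_trace, Matrix.transpose_mul, Matrix.mul_assoc,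
    ← Matrix.mul_assoc M.transpose, hM, Matrix.one_mul]

theorem frobSq_mul_orthogonal {M : Matrix (Fin n) (Fin n) ℝ} (hM : M.transpose * M = 1) :
    frobSq (X * M) = frobSq X := by
  have h : M.transpose.transpose * M.transpose = 1 := by
    rw [Matrix.transpose_transpose]; exact mul_eq_one_comm.mp hM
  rw [← frobSq_transpose, Matrix.transpose_mul, frobSq_orthogonal_mul _ h, frobSq_transpose]

end Frobenius

/-! ### Orthogonal conjugation, diagonal parts and commutator bounds -/

section Rotation

variable {n : ℕ} {C M A : Matrix (Fin n) (Fin n) ℝ}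

theorem IsSymm.rotated (hC : C.IsSymm) (M : Matrix (Fin n) (Fin n) ℝ) :
    (rotated C M).IsSymm := by
  simp [Matrix.IsSymm, CayleyFlow.rotated, Matrix.transpose_mul, hC.eq, Matrix.mul_assoc]

theorem IsSymm.tf (hC : C.IsSymm) : (tf C).IsSymm := by
  simp [Matrix.IsSymm, CayleyFlow.tf, hC.eq]

theorem frobSq_rotated (hM : M.transpose * M = 1) (C : Matrix (Fin n) (Fin n) ℝ) :
    frobSq (rotated C M) = frobSq C := by
  rw [rotated, frobSq_mul_orthogonal _ hM]
  refine frobSq_orthogonal_mul _ ?_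
  rw [Matrix.transpose_transpose]; exact mul_eq_one_comm.mp hM

theorem frobSq_rotated_mul_le (hM : M.transpose * M = 1) (X : Matrix (Fin n) (Fin n) ℝ) :
    frobSq (rotated C M * X) ≤ specNorm C ^ 2 * frobSq X := by
  rw [rotated, Matrix.mul_assoc, Matrix.mul_assoc, frobSq_orthogonal_mul,
    ← frobSq_orthogonal_mul X hM]
  · exact frobSq_mul_le_specNorm _ _
  · rw [Matrix.transpose_transpose]; exact mul_eq_one_comm.mp hM

/-- Left multiplication by `A` enlarges the Frobenius norm by at most the factor `s`. -/
def OpBound (s : ℝ) (A : Matrix (Fin n) (Fin n) ℝ) : Prop :=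
  ∀ X : Matrix (Fin n) (Fin n) ℝ, frobSq (A * X) ≤ s ^ 2 * frobSq X

/-- The matrix unit `single i i 1` isolates column `i` of `A`. -/
theorem OpBound.sq_diag_le {s : ℝ} (h : OpBound s A) (i : Fin n) : A i i ^ 2 ≤ s ^ 2 := by
  have h1 := h (Matrix.single i i 1)
  have h2 := sq_apply_le_frobSq (A * Matrix.single i i 1) i i
  have h3 : frobSq (Matrix.single i i (1 : ℝ)) = 1 := by
    simp only [frobSq, Matrix.single_apply]
    rw [Finset.sum_eq_single i, Finset.sum_eq_single i]
    · simp
    · intro j _ hj; simp [hj.symm]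
    · simp
    · intro j _ hj; simp [hj.symm]
    · simp
  rw [h3] at h1
  simp at h2
  linarith

theorem OpBound.diagPart {s : ℝ} (h : OpBound s A) : OpBound s (diagPart A) := by
  intro X
  simp only [frobSq, CayleyFlow.diagPart, Matrix.diagonal_mul, Finset.mul_sum, mul_pow]
  refine Finset.sum_le_sum fun i _ => Finset.sum_le_sum fun j _ => ?_
  exact mul_le_mul_of_nonneg_right (h.sq_diag_le i) (sq_nonneg _)

theorem OpBound.mul_right {s : ℝ} (h : OpBound s A) (hA : A.IsSymm)
    (X : Matrix (Fin n) (Fin n) ℝ) : frobSq (X * A) ≤ s ^ 2 * frobSq X := by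
  rw [← frobSq_transpose, Matrix.transpose_mul, hA.eq, ← frobSq_transpose X]
  exact h _

theorem OpBound.commutator {s : ℝ} (h : OpBound s A) (hA : A.IsSymm)
    (X : Matrix (Fin n) (Fin n) ℝ) : frobSq (A * X - X * A) ≤ 4 * s ^ 2 * frobSq X := by
  linarith [frobSq_sub_le (A * X) (X * A), h X, h.mul_right hA X]

theorem OpBound.commutator' {s : ℝ} (h : OpBound s A) (hA : A.IsSymm)
    (X : Matrix (Fin n) (Fin n) ℝ) : frobSq (X * A - A * X) ≤ 4 * s ^ 2 * frobSq X := by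
  linarith [frobSq_sub_le (X * A) (A * X), h X, h.mul_right hA X]

theorem diagPart_isSymm (A : Matrix (Fin n) (Fin n) ℝ) : (diagPart A).IsSymm :=
  Matrix.isSymm_diagonal _

theorem frobSq_diagPart (A : Matrix (Fin n) (Fin n) ℝ) :
    frobSq (diagPart A) = ∑ i, A i i ^ 2 := by
  simp only [frobSq, diagPart]
  refine Finset.sum_congr rfl fun i _ => ?_
  rw [Finset.sum_eq_single i]
  · simp
  · intro j _ hj; simp [Matrix.diagonal_apply_ne _ hj.symm]
  · simp

theorem frobInner_diagPart (A B : Matrix (Fin n) (Fin n) ℝ) :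
    frobInner (diagPart A) B = ∑ i, A i i * B i i := by
  simp only [frobInner, diagPart]
  refine Finset.sum_congr rfl fun i _ => ?_
  rw [Finset.sum_eq_single i]
  · simp
  · intro j _ hj; simp [Matrix.diagonal_apply_ne _ hj.symm]
  · simp

theorem frobSq_sub_diagPart (A : Matrix (Fin n) (Fin n) ℝ) :
    frobSq (A - diagPart A) = frobSq A - ∑ i, A i i ^ 2 := by
  have h : frobInner A (diagPart A) = ∑ i, A i i ^ 2 := by
    have := frobInner_diagPart A A
    simp only [frobInner] at this ⊢
    simp only [mul_comm (A _ _) (diagPart A _ _), this, sq]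
  rw [frobSq_sub, h, frobSq_diagPart]
  ring

theorem frobSq_diagPart_le (A : Matrix (Fin n) (Fin n) ℝ) : frobSq (diagPart A) ≤ frobSq A := by
  have := frobSq_nonneg (A - diagPart A)
  rw [frobSq_sub_diagPart] at this
  rw [frobSq_diagPart]
  linarith

theorem frobSq_mul_le (A B : Matrix (Fin n) (Fin n) ℝ) :
    frobSq (A * B) ≤ frobSq A * frobSq B := by
  rw [← frobSq_transpose B]
  simp only [frobSq, Matrix.mul_apply, Matrix.transpose_apply, Finset.sum_mul]
  refine Finset.sum_le_sum fun i _ => ?_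
  rw [← Finset.sum_mul, Finset.mul_sum]
  exact Finset.sum_le_sum fun j _ => Finset.sum_mul_sq_le_sq_mul_sq _ _ _

end Rotation

/-! ### The Cayley map of a skew matrix -/

section Cayley

variable {n : ℕ} {X : Matrix (Fin n) (Fin n) ℝ}

theorem frobInner_mul_skew (hX : X.transpose = -X) (Y : Matrix (Fin n) (Fin n) ℝ) :
    frobInner Y (Y * X) = 0 := by
  have h : (Y.transpose * (Y * X)).trace = -(Y.transpose * (Y * X)).trace := by
    conv_lhs => rw [← Matrix.trace_transpose, Matrix.transpose_mul, Matrix.transpose_mul,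
      Matrix.transpose_transpose, hX, Matrix.mul_assoc, Matrix.neg_mul, Matrix.trace_neg,
      Matrix.trace_mul_comm, Matrix.mul_assoc]
  rw [frobInner_eq_trace]
  linarith

/-- Pythagoras: `Y` and `Y X` are orthogonal because `Yᵀ Y` is symmetric and `X` is skew. Both the
invertibility of `1 - X/2` and the contractivity of its inverse come from here. -/
theorem frobSq_le_mul_one_sub_skew (hX : X.transpose = -X) (Y : Matrix (Fin n) (Fin n) ℝ) :
    frobSq Y ≤ frobSq (Y * (1 - (1 / 2 : ℝ) • X)) := by
  rw [Matrix.mul_sub, Matrix.mul_one, Matrix.mul_smul, frobSq_sub, frobInner_smul_right,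
    frobInner_mul_skew hX]
  linarith [frobSq_nonneg ((1 / 2 : ℝ) • (Y * X))]

theorem isUnit_det_one_sub_skew (hX : X.transpose = -X) :
    IsUnit (1 - (1 / 2 : ℝ) • X).det := by
  rw [isUnit_iff_ne_zero]
  intro h0
  obtain ⟨v, hv, hv0⟩ := Matrix.exists_vecMul_eq_zero_iff.mpr h0
  apply hv
  -- All rows are equal to the kernel vector `v`, so the product vanishes and the matrix inequality
  -- forces `v = 0`.
  have h1 := frobSq_le_mul_one_sub_skew hX (Matrix.of fun _ => v)
  have h2 : (Matrix.of fun _ => v : Matrix (Fin n) (Fin n) ℝ) * (1 - (1 / 2 : ℝ) • X) = 0 := by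
    ext i j
    exact congrFun hv0 j
  rw [h2] at h1
  have h3 : frobSq (0 : Matrix (Fin n) (Fin n) ℝ) = 0 := by simp [frobSq]
  funext j
  have h4 := sq_apply_le_frobSq (Matrix.of fun _ => v : Matrix (Fin n) (Fin n) ℝ) j j
  have h5 : v j ^ 2 ≤ 0 := by
    have : v j ^ 2 ≤ frobSq (Matrix.of fun _ => v : Matrix (Fin n) (Fin n) ℝ) := h4
    linarith
  exact pow_eq_zero_iff (two_ne_zero) |>.mp (le_antisymm h5 (sq_nonneg _))

/-- The resolvent `(1 - X/2)⁻¹` of the Cayley map. -/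
noncomputable def resolvent (X : Matrix (Fin n) (Fin n) ℝ) : Matrix (Fin n) (Fin n) ℝ :=
  (1 - (1 / 2 : ℝ) • X)⁻¹

theorem resolvent_mul (hX : X.transpose = -X) : resolvent X * (1 - (1 / 2 : ℝ) • X) = 1 :=
  Matrix.nonsing_inv_mul _ (isUnit_det_one_sub_skew hX)

theorem mul_resolvent (hX : X.transpose = -X) : (1 - (1 / 2 : ℝ) • X) * resolvent X = 1 :=
  Matrix.mul_nonsing_inv _ (isUnit_det_one_sub_skew hX)

theorem transpose_resolvent_mul (hX : X.transpose = -X) :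
    (resolvent X).transpose * (1 + (1 / 2 : ℝ) • X) = 1 := by
  have h := congrArg Matrix.transpose (mul_resolvent hX)
  simpa [Matrix.transpose_mul, hX] using h

theorem cay_eq (hX : X.transpose = -X) : cay X = 2 • resolvent X - 1 := by
  have h : (1 + (1 / 2 : ℝ) • X) = 2 • 1 - (1 - (1 / 2 : ℝ) • X) := by
    rw [two_nsmul]; abel
  change resolvent X * _ = _
  rw [h, Matrix.mul_sub, resolvent_mul hX, Matrix.mul_smul, Matrix.mul_one]

/-- With `Z` the resolvent, `cay X = 2Z - 1`, `X Z = 2Z - 2` and `Zᵀ X = 2 - 2Zᵀ`; both sides become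
`4 Zᵀ A Z - 2 Zᵀ A - 2 A Z`. The case `A = 1` is orthogonality of `cay X`. -/
theorem cay_conj_sub (hX : X.transpose = -X) (A : Matrix (Fin n) (Fin n) ℝ) :
    (cay X).transpose * A * cay X - A =
      (resolvent X).transpose * (A * X - X * A) * resolvent X := by
  have h1 := mul_resolvent hX
  have h2 := transpose_resolvent_mul hX
  rw [cay_eq hX]
  set Z := resolvent X with hZ
  rw [Matrix.transpose_sub, Matrix.transpose_smul, Matrix.transpose_one]
  have e1 : X * Z = 2 • Z - 2 • (1 : Matrix (Fin n) (Fin n) ℝ) := by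
    rw [← h1, Matrix.sub_mul, Matrix.one_mul, Matrix.smul_mul, smul_sub, ← Nat.cast_smul_eq_nsmul ℝ,
      ← Nat.cast_smul_eq_nsmul ℝ, smul_smul]
    norm_num
  have e2 : Z.transpose * X = 2 • (1 : Matrix (Fin n) (Fin n) ℝ) - 2 • Z.transpose := by
    rw [← h2, Matrix.mul_add, Matrix.mul_one, Matrix.mul_smul, smul_add,
      ← Nat.cast_smul_eq_nsmul ℝ, ← Nat.cast_smul_eq_nsmul ℝ, smul_smul]
    norm_num
  have e3 : Z.transpose * (A * X - X * A) * Z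
      = Z.transpose * A * (X * Z) - Z.transpose * X * A * Z := by noncomm_ring
  rw [e3, e1, e2]
  noncomm_ring

theorem cay_orthogonal (hX : X.transpose = -X) : (cay X).transpose * cay X = 1 := by
  have h := cay_conj_sub hX 1
  simp only [Matrix.mul_one, Matrix.one_mul, sub_self, Matrix.mul_zero, Matrix.zero_mul] at h
  exact sub_eq_zero.mp h

theorem frobSq_mul_resolvent_le (hX : X.transpose = -X) (S : Matrix (Fin n) (Fin n) ℝ) :
    frobSq (S * resolvent X) ≤ frobSq S := by
  have h := frobSq_le_mul_one_sub_skew hX (S * resolvent X)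
  rwa [Matrix.mul_assoc, resolvent_mul hX, Matrix.mul_one] at h

theorem frobSq_resolvent_sub_one_le (hX : X.transpose = -X) :
    frobSq (resolvent X - 1) ≤ 1 / 4 * frobSq X := by
  have h : resolvent X - 1 = ((1 / 2 : ℝ) • X) * resolvent X := by
    have := mul_resolvent hX
    rw [Matrix.sub_mul, Matrix.one_mul] at this
    rw [← this]; abel
  rw [h]
  refine (frobSq_mul_resolvent_le hX _).trans ?_
  rw [frobSq_smul]; norm_num

theorem generator_transpose {C M : Matrix (Fin n) (Fin n) ℝ} (hC : C.IsSymm) :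
    (generator C M).transpose = -generator C M := by
  simp only [generator, Matrix.transpose_sub, Matrix.transpose_mul, (IsSymm.rotated hC M).eq,
    (diagPart_isSymm (rotated C M)).eq]
  abel

/-- First-order expansion of the diagonal quadratic form along the Cayley map. -/
theorem neg_frobInner_diagPart_cay_le {A : Matrix (Fin n) (Fin n) ℝ} {s : ℝ} (hA : A.IsSymm)
    (hs : OpBound s A) (hX : X.transpose = -X) :
    -frobInner (diagPart A) ((cay X).transpose * A * cay X - A) ≤
      -frobInner (A * diagPart A - diagPart A * A) X + 2 * s ^ 2 * frobSq X := by
  rw [cay_conj_sub hX]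
  set Z := resolvent X with hZ
  set S := A * X - X * A with hS
  set D := diagPart A with hD
  have hDs : D.transpose = D := diagPart_isSymm A
  have hSs : S.transpose = S := by
    simp only [hS, Matrix.transpose_sub, Matrix.transpose_mul, hA.eq, hX]
    simp; abel
  have hswap : (D * Z.transpose * S).trace = (D * S * Z).trace := by
    rw [← Matrix.trace_transpose, Matrix.transpose_mul, Matrix.transpose_mul, hDs, hSs,
      Matrix.transpose_transpose, ← Matrix.mul_assoc, Matrix.trace_mul_comm, ← Matrix.mul_assoc]
  -- The symmetry `hswap` makes the remainder a product of two factors, `(Z - 1) D` and `S (Z + 1)`,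
  -- each of first order in `X`.
  have hid : frobInner D (Z.transpose * S * Z) =
      frobInner D S + frobInner ((Z - 1) * D) (S * (Z + 1)) := by
    simp only [frobInner_eq_trace, Matrix.transpose_mul, hDs, Matrix.transpose_sub,
      Matrix.transpose_one]
    have : D * (Z.transpose - 1) * (S * (Z + 1)) =
        D * (Z.transpose * S * Z) - D * S + (D * Z.transpose * S - D * S * Z) := by
      noncomm_ring
    rw [this, Matrix.trace_add, Matrix.trace_sub, Matrix.trace_sub, hswap]
    ring
  have hmain : frobInner D S = frobInner (A * D - D * A) X := by
    simp only [frobInner_eq_trace, hDs, Matrix.transpose_sub, Matrix.transpose_mul, hA.eq, hS,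
      Matrix.mul_sub, Matrix.sub_mul, Matrix.trace_sub]
    rw [← Matrix.mul_assoc, ← Matrix.mul_assoc, Matrix.trace_mul_comm (D * X) A, ← Matrix.mul_assoc]
  have hneg : -frobInner ((Z - 1) * D) (S * (Z + 1)) =
      frobInner ((Z - 1) * D) ((-1 : ℝ) • (S * (Z + 1))) := by
    rw [frobInner_smul_right]; ring
  -- Young's weights `4` and `1/16` balance the bounds `s²/4` and `16 s²` below: each term
  -- contributes `s² ‖X‖_F²`.
  have hb := frobInner_le_four_mul_add ((Z - 1) * D) ((-1 : ℝ) • (S * (Z + 1)))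
  rw [frobSq_smul] at hb
  have h1 : frobSq ((Z - 1) * D) ≤ s ^ 2 * (1 / 4 * frobSq X) :=
    (hs.diagPart.mul_right (diagPart_isSymm A) _).trans
      (mul_le_mul_of_nonneg_left (frobSq_resolvent_sub_one_le hX) (sq_nonneg s))
  have h2 : frobSq (S * (Z + 1)) ≤ 4 * (4 * s ^ 2 * frobSq X) := by
    rw [Matrix.mul_add, Matrix.mul_one]
    have := frobSq_mul_resolvent_le hX S
    linarith [frobSq_add_le (S * Z) S, hs.commutator hA X]
  rw [hid, hmain]
  linarith

end Cayley

/-! ### Descent, gradient domination and perturbation of the generator -/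

section Descent

variable {n : ℕ} {C M : Matrix (Fin n) (Fin n) ℝ}

theorem opBound_rotated (hM : M.transpose * M = 1) (C : Matrix (Fin n) (Fin n) ℝ) :
    OpBound (specNorm C) (rotated C M) := fun X => frobSq_rotated_mul_le hM X

theorem rotated_add_smul_one (hM : M.transpose * M = 1) (C : Matrix (Fin n) (Fin n) ℝ) (a : ℝ) :
    rotated (C + a • 1) M = rotated C M + a • 1 := by
  simp [rotated, Matrix.mul_add, Matrix.add_mul, hM]

theorem generator_add_smul_one (hM : M.transpose * M = 1) (C : Matrix (Fin n) (Fin n) ℝ)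
    (a : ℝ) : generator (C + a • 1) M = generator C M := by
  have h : diagPart (rotated C M + a • 1) = diagPart (rotated C M) + a • 1 := by
    ext i j
    by_cases hij : i = j
    · subst hij; simp [diagPart]
    · simp [diagPart, hij]
  rw [generator, generator, rotated_add_smul_one hM, h]
  simp only [Matrix.add_mul, Matrix.mul_add, Matrix.smul_mul, Matrix.mul_smul, Matrix.one_mul,
    Matrix.mul_one, smul_add]
  abel

theorem tf_add (C E : Matrix (Fin n) (Fin n) ℝ) : tf (C + E) = tf C + tf E := by
  simp only [tf, Matrix.trace_add, add_div, add_smul]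
  abel

theorem generator_tf (hM : M.transpose * M = 1) (C : Matrix (Fin n) (Fin n) ℝ) :
    generator (tf C) M = generator C M := by
  rw [tf, sub_eq_add_neg, ← neg_smul, generator_add_smul_one hM]

/-- One Cayley step decreases the objective up to a quadratic error. -/
theorem objective_mul_cay_le (hC : C.IsSymm) (hM : M.transpose * M = 1)
    {X : Matrix (Fin n) (Fin n) ℝ} (hX : X.transpose = -X) :
    objective C (M * cay X) ≤ objective C M - frobInner (generator C M) X
      + 2 * specNorm (tf C) ^ 2 * frobSq X := by
  have hrot : rotated (tf C) (M * cay X) =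
      (cay X).transpose * rotated (tf C) M * cay X := by
    simp [rotated, Matrix.transpose_mul, Matrix.mul_assoc]
  have hMQ : (M * cay X).transpose * (M * cay X) = 1 := by
    rw [Matrix.transpose_mul, Matrix.mul_assoc, ← Matrix.mul_assoc M.transpose, hM,
      Matrix.one_mul, cay_orthogonal hX]
  have key := neg_frobInner_diagPart_cay_le (IsSymm.rotated (IsSymm.tf hC) M)
    (opBound_rotated hM (tf C)) hX
  rw [← hrot] at key
  rw [← generator_tf hM]
  change _ ≤ -frobInner (generator (tf C) M) X + _ at key
  rw [frobInner_diagPart] at key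
  simp only [objective, frobSq_sub_diagPart, frobSq_rotated hM, frobSq_rotated hMQ]
  set A := rotated (tf C) M
  set B := rotated (tf C) (M * cay X)
  -- Convexity of the square, entry by entry: `a (b - a) ≤ ½ b² - ½ a²`.
  have hconv : ∑ i, A i i * (B - A) i i ≤ 1 / 2 * ∑ i, B i i ^ 2 - 1 / 2 * ∑ i, A i i ^ 2 := by
    rw [Finset.mul_sum, Finset.mul_sum, ← Finset.sum_sub_distrib]
    refine Finset.sum_le_sum fun i _ => ?_
    rw [Matrix.sub_apply]
    nlinarith [sq_nonneg (B i i - A i i)]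
  linarith

theorem objective_nonneg (C M : Matrix (Fin n) (Fin n) ℝ) : 0 ≤ objective C M :=
  mul_nonneg (by norm_num) (frobSq_nonneg _)

theorem objective_le (hM : M.transpose * M = 1) (C : Matrix (Fin n) (Fin n) ℝ) :
    objective C M ≤ 1 / 2 * frobSq (tf C) := by
  rw [objective, frobSq_sub_diagPart, frobSq_rotated hM]
  have : 0 ≤ ∑ i, rotated (tf C) M i i ^ 2 := Finset.sum_nonneg fun _ _ => sq_nonneg _
  linarith

theorem orthogonal_of_separated {δ : ℝ} (h : M ∈ separated C δ) : M.transpose * M = 1 := by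
  have := (Matrix.mem_specialOrthogonalGroup_iff.mp h.1).1
  exact (Matrix.mem_orthogonalGroup_iff' (Fin n) ℝ).mp this

theorem generator_apply (C M : Matrix (Fin n) (Fin n) ℝ) (i j : Fin n) :
    generator C M i j = rotated C M i j * (rotated C M j j - rotated C M i i) := by
  simp [generator, diagPart, Matrix.mul_diagonal, Matrix.diagonal_mul]; ring

/-- Gradient domination on the separation domain. -/
theorem two_mul_objective_le {δ : ℝ} (hδ : 0 < δ) (h : M ∈ separated C δ) :
    2 * δ ^ 2 * objective C M ≤ frobSq (generator C M) := by
  rw [← generator_tf (orthogonal_of_separated h), objective]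
  have : 2 * δ ^ 2 * (1 / 2 * frobSq (rotated (tf C) M - diagPart (rotated (tf C) M))) =
      δ ^ 2 * frobSq (rotated (tf C) M - diagPart (rotated (tf C) M)) := by ring
  rw [this]
  simp only [frobSq, Finset.mul_sum, generator_apply]
  refine Finset.sum_le_sum fun i _ => Finset.sum_le_sum fun j _ => ?_
  by_cases hij : i = j
  · subst hij; simp [diagPart]
  · have h1 := h.2 j i (Ne.symm hij)
    have h2 : δ ^ 2 ≤ (rotated (tf C) M j j - rotated (tf C) M i i) ^ 2 := by
      rw [← sq_abs (_ - _)]; exact pow_le_pow_left₀ hδ.le h1 2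
    simp only [diagPart, Matrix.sub_apply, Matrix.diagonal_apply_ne _ hij, sub_zero, mul_pow]
    rw [mul_comm]
    exact mul_le_mul_of_nonneg_left h2 (sq_nonneg _)

/-- Two distinct diagonal entries exist since `n ≥ 2`, and each is at most `‖C_e‖₂` in absolute
value. This yields `L_C ≥ 2δ² > 0`, hence `β ≤ ℓ` in the recursion. -/
theorem sq_separation_le {δ : ℝ} (hn : 2 ≤ n) (hδ : 0 < δ) (h : M ∈ separated C δ) :
    δ ^ 2 ≤ 4 * specNorm (tf C) ^ 2 := by
  have hb := opBound_rotated (orthogonal_of_separated h) (tf C)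
  have h0 := hb.sq_diag_le ⟨0, by omega⟩
  have h1 := hb.sq_diag_le ⟨1, by omega⟩
  have h2 := h.2 ⟨0, by omega⟩ ⟨1, by omega⟩ (by simp)
  have h3 := pow_le_pow_left₀ hδ.le h2 2
  rw [sq_abs] at h3
  nlinarith [sq_nonneg (rotated (tf C) M ⟨0, by omega⟩ ⟨0, by omega⟩ +
    rotated (tf C) M ⟨1, by omega⟩ ⟨1, by omega⟩)]

theorem frobSq_generator_le (hC : C.IsSymm) (hM : M.transpose * M = 1) :
    frobSq (generator C M) ≤ 4 * specNorm C ^ 2 * frobSq C := by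
  have h := (opBound_rotated hM C).commutator (IsSymm.rotated hC M) (diagPart (rotated C M))
  have h2 := frobSq_diagPart_le (rotated C M)
  rw [frobSq_rotated hM] at h2
  exact h.trans (mul_le_mul_of_nonneg_left h2 (by positivity))

theorem diagPart_add (A B : Matrix (Fin n) (Fin n) ℝ) :
    diagPart (A + B) = diagPart A + diagPart B := by
  simp [diagPart, Matrix.diagonal_add]

/-- Perturbation bound for the commutator generator. -/
theorem frobSq_generator_add_sub_le {E : Matrix (Fin n) (Fin n) ℝ} (hC : C.IsSymm)
    (hM : M.transpose * M = 1) :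
    frobSq (generator (C + E) M - generator C M) ≤
      32 * specNorm (tf C) ^ 2 * frobSq (tf E) + 8 * frobSq (tf E) ^ 2 := by
  rw [← generator_tf hM (C + E), ← generator_tf hM C, tf_add]
  have hAB : rotated (tf C + tf E) M = rotated (tf C) M + rotated (tf E) M := by
    simp [rotated, Matrix.mul_add, Matrix.add_mul]
  have hBE := frobSq_rotated hM (tf E)
  have hs := opBound_rotated hM (tf C)
  have hAs := IsSymm.rotated (IsSymm.tf hC) M
  simp only [generator, hAB, diagPart_add]
  set A := rotated (tf C) M
  set B := rotated (tf E) M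
  have hDB := frobSq_diagPart_le B
  -- Two terms linear in `B` and one quadratic. Each linear one costs `4 s² ‖B‖_F²`, the quadratic
  -- one `4 ‖B‖_F⁴`; two uses of `frobSq_add_le` give `32` and `8`.
  have e : (A + B) * (diagPart A + diagPart B) - (diagPart A + diagPart B) * (A + B)
      - (A * diagPart A - diagPart A * A) =
      ((A * diagPart B - diagPart B * A) + (B * diagPart A - diagPart A * B)) +
        (B * diagPart B - diagPart B * B) := by noncomm_ring
  rw [e, ← hBE]
  have h0 := frobSq_nonneg (diagPart B)
  have h1 := (hs.commutator hAs (diagPart B)).trans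
    (mul_le_mul_of_nonneg_left hDB (by positivity))
  have h2 := hs.diagPart.commutator' (diagPart_isSymm A) B
  have h3 : frobSq (B * diagPart B - diagPart B * B) ≤ 4 * frobSq B ^ 2 := by
    have := mul_le_mul_of_nonneg_left hDB (frobSq_nonneg B)
    linarith [frobSq_sub_le (B * diagPart B) (diagPart B * B), frobSq_mul_le B (diagPart B),
      frobSq_mul_le (diagPart B) B]
  linarith [frobSq_add_le ((A * diagPart B - diagPart B * A) + (B * diagPart A - diagPart A * B))
    (B * diagPart B - diagPart B * B),
    frobSq_add_le (A * diagPart B - diagPart B * A) (B * diagPart A - diagPart A * B)]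

end Descent

/-! ### The scalar recursion -/

section Recursion

/-- A step of the recursion preserves `a ≤ C/κ · (1 - ℓ/(2κ))`. -/
theorem rate_step {a a' C N β ℓ κ : ℝ} (hβ : 1 < β) (hβℓ : β ≤ ℓ) (hℓκ : ℓ < κ) (hC : 0 ≤ C)
    (hN : N ≤ C)
    (hrec : a' ≤ (1 - β * (1 - ℓ / (4 * κ)) / κ) * a + (β - 1) * N / (4 * κ ^ 2))
    (ha : a ≤ C / κ * (1 - ℓ / (2 * κ))) :
    a' ≤ C / (κ + 1) * (1 - ℓ / (2 * (κ + 1))) := by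
  have hκ : 0 < κ := by linarith
  obtain ⟨x, rfl⟩ : ∃ x, ℓ = x * κ := ⟨ℓ / κ, by field_simp⟩
  have hx0 : 0 < x := by
    by_contra h; push Not at h; nlinarith
  have hx1 : x < 1 := by
    by_contra h; push Not at h; nlinarith
  have hκ1 : 1 < κ := by linarith
  have e1 : x * κ / (4 * κ) = x / 4 := by field_simp
  have e2 : x * κ / (2 * κ) = x / 2 := by field_simp
  rw [e1] at hrec
  rw [e2] at ha
  have hcoef : 0 ≤ 1 - β * (1 - x / 4) / κ := by
    rw [sub_nonneg, div_le_one hκ]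
    nlinarith
  have h1 : a' ≤ (1 - β * (1 - x / 4) / κ) * (C / κ * (1 - x / 2)) +
      (β - 1) * C / (4 * κ ^ 2) := by
    refine hrec.trans (add_le_add (mul_le_mul_of_nonneg_left ha hcoef) ?_)
    gcongr
  refine h1.trans ?_
  -- Affine in `β`: `hb` shows that the slope is nonnegative, and `hfin` covers `β = 1`.
  have hg : 0 ≤ -1 + 1 / (κ + 1) + x - x * (3 * κ + 2) / (2 * (κ + 1) ^ 2)
      + β * (1 - 3 * x / 4 + x ^ 2 / 8) - (β - 1) / 4 := by
    have hb : 0 ≤ (β - 1) * (3 / 4 - 3 * x / 4 + x ^ 2 / 8) :=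
      mul_nonneg (by linarith) (by nlinarith)
    have hy : x * (3 * κ + 2) / (2 * (κ + 1) ^ 2) ≤ 3 / 2 * x * (1 / (κ + 1)) := by
      rw [div_le_iff₀ (by positivity)]
      have : 3 / 2 * x * (1 / (κ + 1)) * (2 * (κ + 1) ^ 2) = 3 * x * (κ + 1) := by
        field_simp
      rw [this]; nlinarith
    have hz0 : 0 < 1 / (κ + 1) := by positivity
    have hz1 : 1 / (κ + 1) ≤ 1 / 2 := one_div_le_one_div_of_le (by norm_num) (by linarith)
    set z := 1 / (κ + 1)
    have hfin : 0 ≤ x / 4 + x ^ 2 / 8 + z - 3 / 2 * x * z := by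
      rcases le_total x (2 / 3) with h | h
      · nlinarith [mul_nonneg hz0.le (by linarith : (0:ℝ) ≤ 1 - 3 / 2 * x)]
      -- Here `z = 1/2` is the worst case, and it leaves `(x - 2)² / 8`.
      · nlinarith [mul_nonneg (by linarith : (0:ℝ) ≤ 1 / 2 - z)
          (by linarith : (0:ℝ) ≤ 3 / 2 * x - 1)]
    nlinarith
  rw [← sub_nonneg]
  have e3 : C / (κ + 1) * (1 - x * κ / (2 * (κ + 1))) -
      ((1 - β * (1 - x / 4) / κ) * (C / κ * (1 - x / 2)) + (β - 1) * C / (4 * κ ^ 2)) =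
      C / κ ^ 2 * (-1 + 1 / (κ + 1) + x - x * (3 * κ + 2) / (2 * (κ + 1) ^ 2)
      + β * (1 - 3 * x / 4 + x ^ 2 / 8) - (β - 1) / 4) := by
    field_simp
    ring
  rw [e3]
  exact mul_nonneg (by positivity) hg

/-- A step of the recursion preserves `a ≤ C/κ` as soon as `ℓ/κ ≤ 2 - 2/β`. -/
theorem rate_step_of_le {a a' C N β ℓ κ : ℝ} (hβ : 1 < β) (hβℓ : β ≤ ℓ) (hℓκ : ℓ < κ)
    (hC : 0 ≤ C) (hN : N ≤ C) (hℓ : ℓ / κ ≤ 2 - 2 / β)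
    (hrec : a' ≤ (1 - β * (1 - ℓ / (4 * κ)) / κ) * a + (β - 1) * N / (4 * κ ^ 2))
    (ha : a ≤ C / κ) : a' ≤ C / (κ + 1) := by
  have hκ : 0 < κ := by linarith
  obtain ⟨x, rfl⟩ : ∃ x, ℓ = x * κ := ⟨ℓ / κ, by field_simp⟩
  have e0 : x * κ / κ = x := by field_simp
  rw [e0] at hℓ
  have hβx : β * x ≤ 2 * β - 2 := by
    have := mul_le_mul_of_nonneg_left hℓ (by linarith : (0:ℝ) ≤ β)
    have e : β * (2 - 2 / β) = 2 * β - 2 := by field_simp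
    linarith
  have hx0 : 0 < x := by
    by_contra h; push Not at h; nlinarith
  have e1 : x * κ / (4 * κ) = x / 4 := by field_simp
  rw [e1] at hrec
  have hcoef : 0 ≤ 1 - β * (1 - x / 4) / κ := by
    rw [sub_nonneg, div_le_one hκ]
    nlinarith
  have h1 : a' ≤ (1 - β * (1 - x / 4) / κ) * (C / κ) + (β - 1) * C / (4 * κ ^ 2) := by
    refine hrec.trans (add_le_add (mul_le_mul_of_nonneg_left ha hcoef) ?_)
    gcongr
  refine h1.trans ?_
  rw [← sub_nonneg]
  have e3 : C / (κ + 1) - ((1 - β * (1 - x / 4) / κ) * (C / κ) + (β - 1) * C / (4 * κ ^ 2)) =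
      C / κ ^ 2 * (-1 + 1 / (κ + 1) + β * (1 - x / 4) - (β - 1) / 4) := by
    field_simp
    ring
  rw [e3]
  have : 0 < 1 / (κ + 1) := by positivity
  -- The condition on `ℓ/κ` gives `β (1 - x/4) - 1 ≥ (β - 1)/2`, of which the noise takes `(β -
  -- 1)/4`.
  exact mul_nonneg (by positivity) (by nlinarith)

variable {a : ℕ → ℝ} {N β ℓ k₀ : ℝ}

/-- Whatever the initial value, `a k ≤ N/(k + k₀)` eventually. -/
theorem eventually_rate (hβ : 1 < β) (hβℓ : β ≤ ℓ) (hℓ : ℓ < k₀) (hN : 0 < N)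
    (hrec : ∀ k : ℕ, a (k + 1) ≤ (1 - β * (1 - ℓ / (4 * (k + k₀))) / (k + k₀)) * a k +
      (β - 1) * N / (4 * (k + k₀) ^ 2)) :
    ∃ k₁ : ℕ, ∀ k : ℕ, k₁ ≤ k → a k ≤ N / (k + k₀) := by
  have hk₀ : 0 < k₀ := by linarith
  -- From `m` on, `ℓ/κ ≤ (β - 1)/β`, half of what `rate_step_of_le` allows; the stronger form is
  -- needed for the drop estimate.
  obtain ⟨m, hm⟩ := exists_nat_ge (β * ℓ / (β - 1))
  have hsmall : ∀ k : ℕ, m ≤ k → β * ℓ / (k + k₀) ≤ β - 1 := by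
    intro k hk
    have hmk : (m : ℝ) ≤ k := by exact_mod_cast hk
    rw [div_le_iff₀ (by linarith)] at hm
    have hkp : 0 < (k : ℝ) + k₀ := by positivity
    rw [div_le_iff₀ hkp]
    nlinarith
  have hpers : ∀ k : ℕ, m ≤ k → a k ≤ N / (k + k₀) → a (k + 1) ≤ N / ((k + 1 : ℕ) + k₀) := by
    intro k hk ha
    have hkp : 0 < (k : ℝ) + k₀ := by positivity
    have hkn : (0 : ℝ) ≤ k := by positivity
    have := rate_step_of_le hβ hβℓ (by linarith) hN.le le_rfl ?_ (hrec k) ha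
    · push_cast
      rwa [add_right_comm]
    · have h1 := hsmall k hk
      have hb : 0 < β := by linarith
      have : ℓ / (k + k₀) = (β * ℓ / (k + k₀)) / β := by field_simp
      rw [this, div_le_iff₀ hb]
      have : (2 - 2 / β) * β = 2 * β - 2 := by field_simp
      linarith
  suffices hex : ∃ k, m ≤ k ∧ a k ≤ N / (k + k₀) by
    obtain ⟨k₁, hk₁, h⟩ := hex
    refine ⟨k₁, fun k hk => ?_⟩
    induction k, hk using Nat.le_induction with
    | base => exact h
    | succ k hk ih => exact hpers k (hk₁.trans hk) ih
  by_contra hno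
  push Not at hno
  have hdrop : ∀ k : ℕ, m ≤ k →
      ((k + 1 : ℕ) + k₀) * a (k + 1) ≤ (k + k₀) * a k - (β - 1) * N / 4 / (k + k₀) := by
    intro k hk
    have hkp : 0 < (k : ℝ) + k₀ := by positivity
    have hkn : (0 : ℝ) ≤ k := by positivity
    have h1 := hrec k
    have h2 := hno k hk
    have h3 := hsmall k hk
    push_cast
    have hκ : ℓ < (k : ℝ) + k₀ := by linarith
    have hk1 : ((k : ℝ) + 1 + k₀) = (k + k₀) + 1 := by ring
    rw [hk1]
    set κ := (k : ℝ) + k₀ with hκdef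
    obtain ⟨w, hw⟩ : ∃ w, a k = w / κ := ⟨a k * κ, by field_simp⟩
    rw [hw] at h1 h2 ⊢
    have hwN : N < w := by rwa [div_lt_div_iff_of_pos_right hkp] at h2
    have e1 : κ * (w / κ) = w := by field_simp
    rw [e1]
    have h4 := mul_le_mul_of_nonneg_left h1 (by linarith : 0 ≤ κ + 1)
    refine h4.trans ?_
    rw [← sub_nonneg]
    have e2 : w - (β - 1) * N / 4 / κ -
        (κ + 1) * ((1 - β * (1 - ℓ / (4 * κ)) / κ) * (w / κ) + (β - 1) * N / (4 * κ ^ 2)) =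
        1 / κ * ((β * (1 + 1 / κ) - (β * ℓ / κ) / 4 * (1 + 1 / κ) - 1) * w
          - (β - 1) * N / 4 - (1 + 1 / κ) * ((β - 1) * N / 4)) := by
      field_simp
      ring
    rw [e2]
    have hi0 : 0 < 1 / κ := by positivity
    have hi1 : 1 / κ ≤ 1 := by rw [div_le_one hkp]; linarith
    refine mul_nonneg hi0.le ?_
    set z := 1 / κ
    set u := β * ℓ / κ
    -- Of this drift `3/4 (β - 1)`, the noise uses at most `2/4` since `z ≤ 1`, and `1/4` remains as
    -- the claimed drop.
    have h5 : (3 / 4 : ℝ) * (β - 1) ≤ β * (1 + z) - u / 4 * (1 + z) - 1 := by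
      nlinarith
    have h6 : (3 / 4 : ℝ) * (β - 1) * N ≤ (β * (1 + z) - u / 4 * (1 + z) - 1) * w :=
      mul_le_mul h5 hwN.le hN.le (by nlinarith)
    have h7 : 0 < (β - 1) * N := mul_pos (by linarith) hN
    nlinarith
  have hsum : ∀ j : ℕ, ((m + j : ℕ) + k₀) * a (m + j) ≤ (m + k₀) * a m -
      (β - 1) * N / 4 * ∑ i ∈ Finset.range j, 1 / (((m + i : ℕ) : ℝ) + k₀) := by
    intro j
    induction j with
    | zero => simp
    | succ j ih =>
      have := hdrop (m + j) (by omega)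
      rw [Finset.sum_range_succ, mul_add, mul_one_div]
      rw [← add_assoc m j 1]
      linarith
  have hdiv : Filter.Tendsto (fun j => ∑ i ∈ Finset.range j, 1 / (((m + i : ℕ) : ℝ) + k₀))
      Filter.atTop Filter.atTop := by
    obtain ⟨q, hq⟩ := exists_nat_ge (m + k₀)
    have hns : ¬ Summable fun i : ℕ => 1 / (((m + i : ℕ) : ℝ) + k₀) := by
      intro hs
      refine (not_iff_not.mpr (summable_nat_add_iff (q + 1))).mpr
        Real.not_summable_one_div_natCast ?_
      refine Summable.of_nonneg_of_le (fun i => by positivity) (fun i => ?_) hs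
      refine one_div_le_one_div_of_le (by positivity) ?_
      push_cast
      linarith
    exact (not_summable_iff_tendsto_nat_atTop_of_nonneg fun i => by positivity).mp hns
  have hq : 0 < (β - 1) * N / 4 := by
    have := mul_pos (by linarith : 0 < β - 1) hN
    linarith
  obtain ⟨j, hj⟩ := (hdiv.eventually_ge_atTop (((m + k₀) * a m) / ((β - 1) * N / 4))).exists
  have h1 := hsum j
  rw [div_le_iff₀ hq] at hj
  have h2 := hno (m + j) (by omega)
  have h3 : 0 < ((m + j : ℕ) : ℝ) + k₀ := by positivity
  have h4 : 0 < a (m + j) := lt_trans (by positivity) h2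
  nlinarith [mul_pos h3 h4]

theorem rate_of_recursion {C : ℝ} (hβ : 1 < β) (hβℓ : β ≤ ℓ) (hℓ : ℓ < k₀) (hC : 0 ≤ C)
    (hN : N ≤ C) (h0 : 2 * k₀ * a 0 ≤ C) (ha0 : 0 ≤ a 0)
    (hrec : ∀ k : ℕ, a (k + 1) ≤ (1 - β * (1 - ℓ / (4 * (k + k₀))) / (k + k₀)) * a k +
      (β - 1) * N / (4 * (k + k₀) ^ 2)) (k : ℕ) : a k ≤ C / (k + k₀) := by
  have hk₀ : 0 < k₀ := by linarith
  have key : a k ≤ C / (k + k₀) * (1 - ℓ / (2 * (k + k₀))) := by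
    induction k with
    | zero =>
      have h1 : ℓ / (2 * k₀) ≤ 1 / 2 := by
        rw [div_le_iff₀ (by positivity)]; linarith
      have h2 : a 0 ≤ C / k₀ * (1 / 2) := by
        rw [div_mul_eq_mul_div, le_div_iff₀ hk₀]; linarith
      have h3 : 0 ≤ C / k₀ := by positivity
      simp only [Nat.cast_zero, zero_add]
      nlinarith
    | succ k ih =>
      have hkn : (0 : ℝ) ≤ k := by positivity
      have := rate_step hβ hβℓ (by linarith) hC hN (hrec k) ih
      push_cast
      rwa [add_right_comm]
  refine key.trans (mul_le_of_le_one_right (by positivity) ?_)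
  have : 0 ≤ ℓ / (2 * (k + k₀)) := div_nonneg (by linarith) (by positivity)
  linarith

theorem rate_of_recursion_of_le {C : ℝ} (hβ : 1 < β) (hβℓ : β ≤ ℓ) (hℓ : ℓ < k₀) (hC : 0 ≤ C)
    (hN : N ≤ C) (h0 : k₀ * a 0 ≤ C) (hle : ℓ / k₀ ≤ 2 - 2 / β)
    (hrec : ∀ k : ℕ, a (k + 1) ≤ (1 - β * (1 - ℓ / (4 * (k + k₀))) / (k + k₀)) * a k +
      (β - 1) * N / (4 * (k + k₀) ^ 2)) (k : ℕ) : a k ≤ C / (k + k₀) := by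
  have hk₀ : 0 < k₀ := by linarith
  induction k with
  | zero =>
    simp only [Nat.cast_zero, zero_add]
    rw [le_div_iff₀ hk₀]; linarith
  | succ k ih =>
    have hkn : (0 : ℝ) ≤ k := by positivity
    have := rate_step_of_le hβ hβℓ (by linarith) hC hN ?_ (hrec k) ih
    · push_cast
      rwa [add_right_comm]
    · refine le_trans ?_ hle
      exact div_le_div_of_nonneg_left (by linarith) hk₀ (by linarith)

end Recursion

/-! ### From rates to sample counts -/

section SampleCount

variable {F : ℕ → ℝ} {C k₀ ε : ℝ}

theorem sampleCount_le_ceil (hk₀ : 0 < k₀) (hε : 0 < ε)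
    (h : ∀ k : ℕ, ⌈C / ε⌉₊ ≤ k → F k ≤ C / (k + k₀)) :
    sampleCount F ε ≤ (⌈C / ε⌉₊ : ℕ∞) := by
  refine sInf_le fun k hk => ?_
  have hk' : ⌈C / ε⌉₊ ≤ k := by exact_mod_cast hk
  refine (h k hk').trans ?_
  have h1 := Nat.ceil_le.mp hk'
  rw [div_le_iff₀ hε] at h1
  have : (0 : ℝ) ≤ k := by positivity
  rw [div_le_iff₀ (by positivity)]
  nlinarith

theorem exists_sampleCount_le_ceil (hk₀ : 0 < k₀) (hC : 0 < C)
    (h : ∃ k₁ : ℕ, ∀ k : ℕ, k₁ ≤ k → F k ≤ C / (k + k₀)) :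
    ∃ ε₀ : ℝ, 0 < ε₀ ∧ ∀ ε : ℝ, 0 < ε → ε < ε₀ → sampleCount F ε ≤ (⌈C / ε⌉₊ : ℕ∞) := by
  obtain ⟨k₁, h⟩ := h
  -- For `ε` below this value `C/ε > k₁ + 1`, so every index beyond the ceiling is already in the
  -- range of the rate.
  refine ⟨C / (k₁ + 1), by positivity, fun ε hε hlt => ?_⟩
  refine sampleCount_le_ceil hk₀ hε fun k hk => h k ?_
  have h1 := Nat.ceil_le.mp hk
  rw [div_le_iff₀ hε] at h1
  rw [lt_div_iff₀ (by positivity)] at hlt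
  have : (k₁ : ℝ) ≤ k := by nlinarith
  exact_mod_cast this

end SampleCount

/-! ### Entrywise measurability of the matrix operations -/

section Measurability

variable {n : ℕ} {Ω : Type*} {m : MeasurableSpace Ω} {F G : Ω → Matrix (Fin n) (Fin n) ℝ}

/-- Entrywise measurability of a random matrix. -/
def EntryMeasurable (m : MeasurableSpace Ω) (F : Ω → Matrix (Fin n) (Fin n) ℝ) : Prop :=
  ∀ i j, Measurable[m] fun ω => F ω i j

theorem entryMeasurable_const (A : Matrix (Fin n) (Fin n) ℝ) :
    EntryMeasurable m fun _ : Ω => A := fun _ _ => measurable_const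

theorem EntryMeasurable.mono {m' : MeasurableSpace Ω} (hF : EntryMeasurable m F) (h : m ≤ m') :
    EntryMeasurable m' F := fun i j => (hF i j).mono h le_rfl

theorem EntryMeasurable.add (hF : EntryMeasurable m F) (hG : EntryMeasurable m G) :
    EntryMeasurable m fun ω => F ω + G ω := fun i j => (hF i j).add (hG i j)

theorem EntryMeasurable.sub (hF : EntryMeasurable m F) (hG : EntryMeasurable m G) :
    EntryMeasurable m fun ω => F ω - G ω := fun i j => (hF i j).sub (hG i j)

theorem EntryMeasurable.const_smul (hF : EntryMeasurable m F) (a : ℝ) :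
    EntryMeasurable m fun ω => a • F ω := fun i j => (hF i j).const_mul a

theorem EntryMeasurable.transpose (hF : EntryMeasurable m F) :
    EntryMeasurable m fun ω => (F ω).transpose := fun i j => hF j i

theorem EntryMeasurable.mul (hF : EntryMeasurable m F) (hG : EntryMeasurable m G) :
    EntryMeasurable m fun ω => F ω * G ω := fun i j => by
  simp only [Matrix.mul_apply]
  exact Finset.measurable_fun_sum _ fun k _ => (hF i k).mul (hG k j)

theorem EntryMeasurable.diagPart (hF : EntryMeasurable m F) :
    EntryMeasurable m fun ω => diagPart (F ω) := fun i j => by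
  by_cases h : i = j
  · subst h; simpa [CayleyFlow.diagPart] using hF i i
  · simp [CayleyFlow.diagPart, h]

theorem EntryMeasurable.det (hF : EntryMeasurable m F) : Measurable[m] fun ω => (F ω).det := by
  simp only [Matrix.det_apply']
  exact Finset.measurable_fun_sum _ fun p _ =>
    (Finset.measurable_fun_prod _ fun i _ => hF (p i) i).const_mul _

/-- The adjugate formula is also valid at singular matrices, where both sides are `0`, so no
invertibility is needed. -/
theorem EntryMeasurable.inv (hF : EntryMeasurable m F) :
    EntryMeasurable m fun ω => (F ω)⁻¹ := fun i j => by
  simp only [Matrix.inv_def, Matrix.smul_apply, smul_eq_mul, Ring.inverse_eq_inv',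
    Matrix.adjugate_apply]
  refine hF.det.inv.mul (EntryMeasurable.det fun a b => ?_)
  simp only [Matrix.updateRow_apply]
  split_ifs
  · exact measurable_const
  · exact hF a b

theorem EntryMeasurable.frobSq (hF : EntryMeasurable m F) :
    Measurable[m] fun ω => frobSq (F ω) := by
  simp only [CayleyFlow.frobSq]
  exact Finset.measurable_fun_sum _ fun i _ =>
    Finset.measurable_fun_sum _ fun j _ => (hF i j).pow_const 2

theorem EntryMeasurable.tf (hF : EntryMeasurable m F) :
    EntryMeasurable m fun ω => tf (F ω) := fun i j => by
  simp only [CayleyFlow.tf, Matrix.sub_apply, Matrix.smul_apply, smul_eq_mul, Matrix.trace,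
    Matrix.diag]
  exact (hF i j).sub
    (((Finset.measurable_fun_sum _ fun k _ => hF k k).div_const _).mul_const _)

theorem EntryMeasurable.rotated (hF : EntryMeasurable m F) (hG : EntryMeasurable m G) :
    EntryMeasurable m fun ω => rotated (F ω) (G ω) := (hG.transpose.mul hF).mul hG

theorem EntryMeasurable.generator (hF : EntryMeasurable m F) (hG : EntryMeasurable m G) :
    EntryMeasurable m fun ω => generator (F ω) (G ω) :=
  ((hF.rotated hG).mul (hF.rotated hG).diagPart).sub
    ((hF.rotated hG).diagPart.mul (hF.rotated hG))

theorem EntryMeasurable.cay (hF : EntryMeasurable m F) :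
    EntryMeasurable m fun ω => cay (F ω) :=
  ((entryMeasurable_const 1).sub (hF.const_smul _)).inv.mul
    ((entryMeasurable_const 1).add (hF.const_smul _))

theorem EntryMeasurable.objective (hF : EntryMeasurable m F)
    (C : Matrix (Fin n) (Fin n) ℝ) : Measurable[m] fun ω => objective C (F ω) := by
  have h := (entryMeasurable_const (m := m) (Ω := Ω) (CayleyFlow.tf C)).rotated hF
  exact (h.sub h.diagPart).frobSq.const_mul _

end Measurability

/-! ### The random iterates and their pathwise descent -/

section Trajectory

variable {n : ℕ} {Ω : Type*} {Csig M₀ : Matrix (Fin n) (Fin n) ℝ}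
  {E : ℕ → Ω → Matrix (Fin n) (Fin n) ℝ} {η : ℕ → ℝ}

theorem traj_succ (σ : ℕ → Ω → ℝ) (k : ℕ) (ω : Ω) :
    traj Csig σ E η M₀ (k + 1) ω = traj Csig σ E η M₀ k ω *
      cay (η k • generator (observed Csig σ E k ω) (traj Csig σ E η M₀ k ω)) := rfl

theorem generator_observed (σ : ℕ → Ω → ℝ) (k : ℕ) (ω : Ω) {M : Matrix (Fin n) (Fin n) ℝ}
    (hM : M.transpose * M = 1) :
    generator (observed Csig σ E k ω) M = generator (Csig + E k ω) M := by
  rw [observed, add_right_comm, generator_add_smul_one hM]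

theorem observed_isSymm (hC : Csig.IsSymm) (hE : ∀ k ω, (E k ω).IsSymm) (σ : ℕ → Ω → ℝ)
    (k : ℕ) (ω : Ω) : (observed Csig σ E k ω).IsSymm :=
  (hC.add (Matrix.isSymm_one.smul _)).add (hE k ω)

theorem smul_generator_transpose {C : Matrix (Fin n) (Fin n) ℝ} (hC : C.IsSymm) (a : ℝ)
    (M : Matrix (Fin n) (Fin n) ℝ) :
    (a • generator C M).transpose = -(a • generator C M) := by
  rw [Matrix.transpose_smul, generator_transpose hC, smul_neg]

/-- Holds at every `ω`, whereas separation is only almost sure; the boundedness used for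
integrability rests on this. -/
theorem traj_orthogonal (hC : Csig.IsSymm) (hE : ∀ k ω, (E k ω).IsSymm)
    (hM₀ : M₀.transpose * M₀ = 1) (σ : ℕ → Ω → ℝ) (k : ℕ) (ω : Ω) :
    (traj Csig σ E η M₀ k ω).transpose * traj Csig σ E η M₀ k ω = 1 := by
  induction k with
  | zero => exact hM₀
  | succ k ih =>
    rw [traj_succ, Matrix.transpose_mul, Matrix.mul_assoc,
      ← Matrix.mul_assoc (traj Csig σ E η M₀ k ω).transpose, ih, Matrix.one_mul]
    exact cay_orthogonal (smul_generator_transpose (observed_isSymm hC hE σ k ω) _ _)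

theorem traj_background_free (hC : Csig.IsSymm) (hE : ∀ k ω, (E k ω).IsSymm)
    (hM₀ : M₀.transpose * M₀ = 1) (σ σ' : ℕ → Ω → ℝ) (k : ℕ) (ω : Ω) :
    traj Csig σ' E η M₀ k ω = traj Csig σ E η M₀ k ω := by
  induction k with
  | zero => rfl
  | succ k ih =>
    have h := traj_orthogonal (η := η) hC hE hM₀ σ k ω
    rw [traj_succ, traj_succ, ih, generator_observed σ k ω h, generator_observed σ' k ω h]

theorem generator_observed_eq (σ : ℕ → Ω → ℝ) (k : ℕ) (ω : Ω) :
    generator (observed Csig σ E k ω) (traj Csig σ E η M₀ k ω) =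
      generator Csig (traj Csig σ E η M₀ k ω) + input Csig σ E η M₀ k ω := by
  rw [input]; abel

variable {mΩ : MeasurableSpace Ω} {ℱ : Filtration ℕ mΩ}

/-- Adaptedness requires removing `σ` first, through `generator_observed`, as nothing is known about
its measurability. -/
theorem traj_measurable (hC : Csig.IsSymm) (hE : ∀ k ω, (E k ω).IsSymm)
    (hM₀ : M₀.transpose * M₀ = 1) (hEmeas : ∀ k, EntryMeasurable (ℱ (k + 1)) (E k))
    (σ : ℕ → Ω → ℝ) (k : ℕ) :
    EntryMeasurable (ℱ k) (traj Csig σ E η M₀ k) := by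
  induction k with
  | zero => exact entryMeasurable_const M₀
  | succ k ih =>
    have ih' := ih.mono (ℱ.mono (Nat.le_succ k))
    have h : traj Csig σ E η M₀ (k + 1) = fun ω => traj Csig σ E η M₀ k ω *
        cay (η k • generator (Csig + E k ω) (traj Csig σ E η M₀ k ω)) := by
      funext ω
      rw [traj_succ, generator_observed σ k ω (traj_orthogonal hC hE hM₀ σ k ω)]
    rw [h]
    exact ih'.mul ((((entryMeasurable_const Csig).add (hEmeas k)).generator ih').const_smul _).cay

theorem input_measurable (hC : Csig.IsSymm) (hE : ∀ k ω, (E k ω).IsSymm)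
    (hM₀ : M₀.transpose * M₀ = 1) (hEmeas : ∀ k, EntryMeasurable (ℱ (k + 1)) (E k))
    (σ : ℕ → Ω → ℝ) (k : ℕ) :
    EntryMeasurable (ℱ (k + 1)) (input Csig σ E η M₀ k) := by
  have h : input Csig σ E η M₀ k = fun ω => generator (Csig + E k ω) (traj Csig σ E η M₀ k ω)
      - generator Csig (traj Csig σ E η M₀ k ω) := by
    funext ω
    rw [input, generator_observed σ k ω (traj_orthogonal hC hE hM₀ σ k ω)]
  have hT := (traj_measurable (η := η) hC hE hM₀ hEmeas σ k).mono (ℱ.mono (Nat.le_succ k))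
  rw [h]
  exact (((entryMeasurable_const Csig).add (hEmeas k)).generator hT).sub
    ((entryMeasurable_const Csig).generator hT)

theorem frobSq_input_le (hC : Csig.IsSymm) (hE : ∀ k ω, (E k ω).IsSymm)
    (hM₀ : M₀.transpose * M₀ = 1) (σ : ℕ → Ω → ℝ) (k : ℕ) (ω : Ω) :
    frobSq (input Csig σ E η M₀ k ω) ≤
      32 * specNorm (tf Csig) ^ 2 * frobSq (tf (E k ω)) + 8 * frobSq (tf (E k ω)) ^ 2 := by
  have h := traj_orthogonal (η := η) hC hE hM₀ σ k ω
  rw [input, generator_observed σ k ω h]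
  exact frobSq_generator_add_sub_le hC h

/-- The descent uses only the `8` in `c_n`; the term `2√n` is slack. -/
theorem eight_mul_specNorm_sq_le_lipConst (C : Matrix (Fin n) (Fin n) ℝ) :
    8 * specNorm (tf C) ^ 2 ≤ lipConst C := by
  rw [lipConst, dimConst]
  nlinarith [mul_nonneg (Real.sqrt_nonneg n) (sq_nonneg (specNorm (tf C)))]

/-- Pointwise descent of the objective along the iteration. -/
theorem objective_traj_succ_le (hC : Csig.IsSymm) (hE : ∀ k ω, (E k ω).IsSymm)
    (σ : ℕ → Ω → ℝ) {δ : ℝ} (hδ : 0 < δ) {k : ℕ} {ω : Ω} (hη : 0 ≤ η k)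
    (hηL : lipConst Csig * η k ≤ 4)
    (hsep : traj Csig σ E η M₀ k ω ∈ separated Csig δ) :
    objective Csig (traj Csig σ E η M₀ (k + 1) ω) ≤
      (1 - 2 * δ ^ 2 * η k * (1 - lipConst Csig * η k / 4)) *
        objective Csig (traj Csig σ E η M₀ k ω)
      + (lipConst Csig * η k ^ 2 / 2 - η k) * frobInner (generator Csig (traj Csig σ E η M₀ k ω))
          (input Csig σ E η M₀ k ω)
      + lipConst Csig * η k ^ 2 / 4 * frobSq (input Csig σ E η M₀ k ω) := by
  have hM := orthogonal_of_separated hsep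
  have h1 := objective_mul_cay_le hC hM
    (smul_generator_transpose (observed_isSymm hC hE σ k ω) (η k) (traj Csig σ E η M₀ k ω))
  have h2 := two_mul_objective_le hδ hsep
  have h3 := eight_mul_specNorm_sq_le_lipConst Csig
  rw [← traj_succ, generator_observed_eq, frobInner_smul_right, frobSq_smul] at h1
  set M := traj Csig σ E η M₀ k ω
  set U := input Csig σ E η M₀ k ω
  set L := lipConst Csig
  set e := η k
  have h4 : 2 * specNorm (tf Csig) ^ 2 * (e ^ 2 * frobSq (generator Csig M + U)) ≤
      L / 4 * (e ^ 2 * frobSq (generator Csig M + U)) :=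
    mul_le_mul_of_nonneg_right (by linarith) (mul_nonneg (sq_nonneg _) (frobSq_nonneg _))
  rw [frobInner_add_right, ← frobSq_eq_frobInner] at h1
  rw [frobSq_add] at h1 h4
  have h5 := mul_le_mul_of_nonneg_left h2
    (mul_nonneg hη (by linarith : 0 ≤ 1 - L * e / 4))
  linarith

end Trajectory

/-! ### Passing to expectations -/

section Expectation

variable {n : ℕ} {Ω : Type*} {mΩ : MeasurableSpace Ω} {μ : Measure Ω} [IsProbabilityMeasure μ]

theorem integrable_objective {F : Ω → Matrix (Fin n) (Fin n) ℝ} (hF : EntryMeasurable mΩ F)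
    (hO : ∀ ω, (F ω).transpose * F ω = 1) (C : Matrix (Fin n) (Fin n) ℝ) :
    Integrable (fun ω => objective C (F ω)) μ := by
  refine Integrable.of_bound (hF.objective C).aestronglyMeasurable (1 / 2 * frobSq (tf C))
    (Filter.Eventually.of_forall fun ω => ?_)
  rw [Real.norm_of_nonneg (objective_nonneg _ _)]
  exact objective_le (hO ω) C

theorem integrable_entry {F : Ω → Matrix (Fin n) (Fin n) ℝ} (hF : EntryMeasurable mΩ F)
    (hint : Integrable (fun ω => frobSq (F ω)) μ) (i j : Fin n) :
    Integrable (fun ω => F ω i j) μ := by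
  refine ((integrable_const (1 : ℝ)).add hint).mono' (hF i j).aestronglyMeasurable
    (Filter.Eventually.of_forall fun ω => ?_)
  have h := sq_apply_le_frobSq (F ω) i j
  simp only [Pi.add_apply]
  rw [Real.norm_eq_abs, abs_le]
  constructor <;> nlinarith [sq_nonneg (F ω i j - 1), sq_nonneg (F ω i j + 1)]

/-- A bounded predictable matrix is orthogonal in mean to a conditionally centred one. -/
theorem integral_frobInner_eq_zero {m : MeasurableSpace Ω} (hm : m ≤ mΩ)
    {F U : Ω → Matrix (Fin n) (Fin n) ℝ} (hF : EntryMeasurable m F) {B : ℝ}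
    (hB : ∀ ω, frobSq (F ω) ≤ B) (hU : ∀ i j, Integrable (fun ω => U ω i j) μ)
    (hU0 : ∀ i j, μ[fun ω => U ω i j | m] =ᵐ[μ] 0) :
    Integrable (fun ω => frobInner (F ω) (U ω)) μ ∧ ∫ ω, frobInner (F ω) (U ω) ∂μ = 0 := by
  have hint : ∀ i j, Integrable (fun ω => F ω i j * U ω i j) μ := fun i j => by
    refine (hU i j).bdd_mul (c := √B) ((hF i j).mono hm le_rfl).aestronglyMeasurable
      (Filter.Eventually.of_forall fun ω => ?_)
    exact Real.abs_le_sqrt ((sq_apply_le_frobSq (F ω) i j).trans (hB ω))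
  have hzero : ∀ i j, ∫ ω, F ω i j * U ω i j ∂μ = 0 := fun i j => by
    have h1 := condExp_mul_of_stronglyMeasurable_left (hF i j).stronglyMeasurable
      (hint i j) (hU i j)
    have h2 := integral_condExp (μ := μ) hm (f := fun ω => F ω i j * U ω i j)
    rw [← h2]
    refine integral_eq_zero_of_ae ?_
    filter_upwards [h1, hU0 i j] with ω a b
    have a' : (μ[fun ω => F ω i j * U ω i j | m]) ω = F ω i j * (μ[fun ω => U ω i j | m]) ω := a
    rw [a', b]
    simp
  constructor
  · exact integrable_finsetSum _ fun i _ => integrable_finsetSum _ fun j _ => hint i j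
  · simp only [frobInner]
    rw [integral_finsetSum _ fun i _ => integrable_finsetSum _ fun j _ => hint i j]
    refine Finset.sum_eq_zero fun i _ => ?_
    rw [integral_finsetSum _ fun j _ => hint i j]
    exact Finset.sum_eq_zero fun j _ => hzero i j

/-- Integrability of `f` is not required: otherwise both `∫ f` and the conditional expectation are
`0` by convention. -/
theorem integral_le_of_condExp_le {m : MeasurableSpace Ω} (hm : m ≤ mΩ) {f : Ω → ℝ} {v : ℝ}
    (h : μ[f | m] ≤ᵐ[μ] fun _ => v) : ∫ ω, f ω ∂μ ≤ v := by
  rw [← integral_condExp (μ := μ) hm (f := f)]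
  calc ∫ ω, (μ[f | m]) ω ∂μ ≤ ∫ _, v ∂μ :=
        integral_mono_ae integrable_condExp (integrable_const v) h
    _ = v := by simp

variable {Csig M₀ : Matrix (Fin n) (Fin n) ℝ} {E : ℕ → Ω → Matrix (Fin n) (Fin n) ℝ}
  {η : ℕ → ℝ} {ℱ : Filtration ℕ mΩ}

/-- One-step recursion for the expected objective. -/
theorem meanObj_succ_le (hC : Csig.IsSymm) (hE : ∀ k ω, (E k ω).IsSymm)
    (hM₀ : M₀.transpose * M₀ = 1) (hEmeas : ∀ k, EntryMeasurable (ℱ (k + 1)) (E k))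
    (σ : ℕ → Ω → ℝ) {δ S : ℝ} (hδ : 0 < δ) {k : ℕ} (hη : 0 ≤ η k)
    (hηL : lipConst Csig * η k ≤ 4)
    (hstay : ∀ᵐ ω ∂μ, traj Csig σ E η M₀ k ω ∈ separated Csig δ)
    (hUint : Integrable (fun ω => frobSq (input Csig σ E η M₀ k ω)) μ)
    (hUmean : ∀ i j, μ[fun ω => input Csig σ E η M₀ k ω i j | ℱ k] =ᵐ[μ] 0)
    (hUvar : ∫ ω, frobSq (input Csig σ E η M₀ k ω) ∂μ ≤ S) :
    meanObj μ Csig σ E η M₀ (k + 1) ≤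
      (1 - 2 * δ ^ 2 * η k * (1 - lipConst Csig * η k / 4)) * meanObj μ Csig σ E η M₀ k
      + lipConst Csig * η k ^ 2 / 4 * S := by
  have hO := traj_orthogonal (η := η) hC hE hM₀ σ
  have hT := traj_measurable (η := η) hC hE hM₀ hEmeas σ
  have hf : ∀ j, Integrable (fun ω => objective Csig (traj Csig σ E η M₀ j ω)) μ := fun j =>
    integrable_objective ((hT j).mono (ℱ.le j)) (hO j) Csig
  have hU := (input_measurable (η := η) hC hE hM₀ hEmeas σ k).mono (ℱ.le (k + 1))
  obtain ⟨hi, h0⟩ := integral_frobInner_eq_zero (μ := μ) (ℱ.le k)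
    ((entryMeasurable_const Csig).generator (hT k))
    (fun ω => frobSq_generator_le hC (hO k ω)) (integrable_entry hU hUint) hUmean
  have hL : 0 ≤ lipConst Csig :=
    le_trans (by positivity) (eight_mul_specNorm_sq_le_lipConst Csig)
  set p := 1 - 2 * δ ^ 2 * η k * (1 - lipConst Csig * η k / 4)
  set q := lipConst Csig * η k ^ 2 / 2 - η k
  set r := lipConst Csig * η k ^ 2 / 4
  have hle : meanObj μ Csig σ E η M₀ (k + 1) ≤
      ∫ ω, (p * objective Csig (traj Csig σ E η M₀ k ω)
        + q * frobInner (generator Csig (traj Csig σ E η M₀ k ω)) (input Csig σ E η M₀ k ω)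
        + r * frobSq (input Csig σ E η M₀ k ω)) ∂μ := by
    refine integral_mono_ae (hf (k + 1))
      ((((hf k).const_mul p).add (hi.const_mul q)).add (hUint.const_mul r)) ?_
    filter_upwards [hstay] with ω hω
    exact objective_traj_succ_le hC hE σ hδ hη hηL hω
  have hpq : Integrable (fun ω => p * objective Csig (traj Csig σ E η M₀ k ω)
      + q * frobInner (generator Csig (traj Csig σ E η M₀ k ω)) (input Csig σ E η M₀ k ω)) μ :=
    ((hf k).const_mul p).add (hi.const_mul q)
  rw [integral_add hpq (hUint.const_mul r),
    integral_add ((hf k).const_mul p) (hi.const_mul q), integral_const_mul, integral_const_mul,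
    integral_const_mul, h0, mul_zero, add_zero] at hle
  refine hle.trans (add_le_add le_rfl (mul_le_mul_of_nonneg_left hUvar ?_))
  exact div_nonneg (mul_nonneg hL (sq_nonneg _)) (by norm_num)

end Expectation

end CayleyFlow

/-! ### The convergence theorem -/

theorem theorem5 {n : ℕ} (hn : 2 ≤ n)
    {Ω : Type*} {mΩ : MeasurableSpace Ω} (μ : Measure Ω) [IsProbabilityMeasure μ]
    (ℱ : Filtration ℕ mΩ)
    (Csig : Matrix (Fin n) (Fin n) ℝ) (hCsig : Csig.IsSymm)
    (σ : ℕ → Ω → ℝ)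
    (E : ℕ → Ω → Matrix (Fin n) (Fin n) ℝ) (hEsymm : ∀ k ω, (E k ω).IsSymm)
    (hEmeas : ∀ k i j, Measurable[ℱ (k + 1)] (fun ω => E k ω i j))
    (δ c k₀ σu : ℝ) (hδ : 0 < δ) (hc : 1 / (2 * δ ^ 2) < c) (hk₀ : 0 < k₀)
    (hη : c / k₀ < 1 / CayleyFlow.lipConst Csig)
    (M₀ : Matrix (Fin n) (Fin n) ℝ)
    -- almost surely the iterates stay in the separation domain
    (hstay : ∀ᵐ ω ∂μ, ∀ k,
      CayleyFlow.traj Csig σ E (CayleyFlow.step c k₀) M₀ k ω ∈ CayleyFlow.separated Csig δ)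
    -- the input is square integrable, conditionally centred, with bounded conditional variance
    (hUint : ∀ k, Integrable (fun ω =>
      CayleyFlow.frobSq (CayleyFlow.input Csig σ E (CayleyFlow.step c k₀) M₀ k ω)) μ)
    (hUmean : ∀ k i j,
      μ[fun ω => CayleyFlow.input Csig σ E (CayleyFlow.step c k₀) M₀ k ω i j | ℱ k] =ᵐ[μ] 0)
    (hUvar : ∀ k,
      μ[fun ω => CayleyFlow.frobSq (CayleyFlow.input Csig σ E (CayleyFlow.step c k₀) M₀ k ω) | ℱ k]
        ≤ᵐ[μ] fun _ => σu ^ 2) :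
    -- the `1/k` rate
    (∀ k : ℕ,
      Integrable (fun ω => CayleyFlow.objective Csig
        (CayleyFlow.traj Csig σ E (CayleyFlow.step c k₀) M₀ k ω)) μ ∧
      CayleyFlow.meanObj μ Csig σ E (CayleyFlow.step c k₀) M₀ k ≤
        max (2 * k₀ * CayleyFlow.objective Csig M₀) (CayleyFlow.noiseConst Csig δ c (σu ^ 2))
          / ((k : ℝ) + k₀)) ∧
    -- the rate without the factor `2`; the extra condition holds by itself when `c ≥ 1 / δ²`
    (c / k₀ * CayleyFlow.lipConst Csig ≤ 2 - 1 / (c * δ ^ 2) →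
      ∀ k : ℕ, CayleyFlow.meanObj μ Csig σ E (CayleyFlow.step c k₀) M₀ k ≤
        max (k₀ * CayleyFlow.objective Csig M₀) (CayleyFlow.noiseConst Csig δ c (σu ^ 2))
          / ((k : ℝ) + k₀)) ∧
    -- sample complexity at every accuracy
    (∀ ε : ℝ, 0 < ε →
      CayleyFlow.sampleCount (CayleyFlow.meanObj μ Csig σ E (CayleyFlow.step c k₀) M₀) ε ≤
        (⌈max (2 * k₀ * CayleyFlow.objective Csig M₀)
          (CayleyFlow.noiseConst Csig δ c (σu ^ 2)) / ε⌉₊ : ℕ∞)) ∧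
    -- `k*(ε) = O(L_C σ_u² / (δ² ε))` as `ε → 0`
    (0 < σu → ∃ ε₀ : ℝ, 0 < ε₀ ∧ ∀ ε : ℝ, 0 < ε → ε < ε₀ →
      CayleyFlow.sampleCount (CayleyFlow.meanObj μ Csig σ E (CayleyFlow.step c k₀) M₀) ε ≤
        (⌈CayleyFlow.stepFactor δ c *
          (CayleyFlow.lipConst Csig * σu ^ 2 / (δ ^ 2 * ε))⌉₊ : ℕ∞)) ∧
    -- `k*(ε) = O(‖C_e‖₂² 𝔼‖E_e‖_F² / (δ² ε))` as `ε → 0`, where `v` bounds the second moment of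
    -- the trace-free noise and `r² v` its fourth moment
    (∀ v r : ℝ, 0 < v →
      (∀ k, Integrable (fun ω => CayleyFlow.frobSq (CayleyFlow.tf (E k ω)) ^ 2) μ) →
      (∀ k, μ[fun ω => CayleyFlow.frobSq (CayleyFlow.tf (E k ω)) | ℱ k] ≤ᵐ[μ] fun _ => v) →
      (∀ k, μ[fun ω => CayleyFlow.frobSq (CayleyFlow.tf (E k ω)) ^ 2 | ℱ k]
        ≤ᵐ[μ] fun _ => r ^ 2 * v) →
      ∃ ε₀ : ℝ, 0 < ε₀ ∧ ∀ ε : ℝ, 0 < ε → ε < ε₀ →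
        CayleyFlow.sampleCount (CayleyFlow.meanObj μ Csig σ E (CayleyFlow.step c k₀) M₀) ε ≤
          (⌈CayleyFlow.dimConst n * CayleyFlow.stepFactor δ c *
              (32 * CayleyFlow.specNorm (CayleyFlow.tf Csig) ^ 2 + 8 * r ^ 2) *
            (CayleyFlow.specNorm (CayleyFlow.tf Csig) ^ 2 * v / (δ ^ 2 * ε))⌉₊ : ℕ∞)) ∧
    -- nothing depends on the isotropic background: another one yields the same iterates
    (∀ σ' : ℕ → Ω → ℝ, ∀ k ω,
      CayleyFlow.traj Csig σ' E (CayleyFlow.step c k₀) M₀ k ω =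
        CayleyFlow.traj Csig σ E (CayleyFlow.step c k₀) M₀ k ω) := by
  -- One good sample point suffices to show that the deterministic `M₀` is itself separated.
  obtain ⟨ω₀, hω₀⟩ := hstay.exists
  have hsep₀ : M₀ ∈ CayleyFlow.separated Csig δ := hω₀ 0
  have hM₀ := CayleyFlow.orthogonal_of_separated hsep₀
  have hspec := CayleyFlow.sq_separation_le hn hδ hsep₀
  have hδ2 : 0 < δ ^ 2 := by positivity
  have hs8 := CayleyFlow.eight_mul_specNorm_sq_le_lipConst Csig
  have hL : 2 * δ ^ 2 ≤ CayleyFlow.lipConst Csig := by linarith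
  have hLpos : 0 < CayleyFlow.lipConst Csig := by linarith
  have hcpos : 0 < c := lt_trans (by positivity) hc
  have hβ : 1 < 2 * c * δ ^ 2 := by
    rw [div_lt_iff₀ (by positivity)] at hc
    linarith
  have hβℓ : 2 * c * δ ^ 2 ≤ c * CayleyFlow.lipConst Csig := by
    nlinarith
  have hℓ : c * CayleyFlow.lipConst Csig < k₀ := by
    rw [div_lt_div_iff₀ hk₀ hLpos] at hη
    linarith
  have hEm : ∀ k, CayleyFlow.EntryMeasurable (ℱ (k + 1)) (E k) := hEmeas
  have hO := CayleyFlow.traj_orthogonal (η := CayleyFlow.step c k₀) hCsig hEsymm hM₀ σ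
  have hT := CayleyFlow.traj_measurable (η := CayleyFlow.step c k₀) hCsig hEsymm hM₀ hEm σ
  have hf : ∀ k, Integrable (fun ω => CayleyFlow.objective Csig
      (CayleyFlow.traj Csig σ E (CayleyFlow.step c k₀) M₀ k ω)) μ := fun k =>
    CayleyFlow.integrable_objective ((hT k).mono (ℱ.le k)) (hO k) Csig
  have h0 : CayleyFlow.meanObj μ Csig σ E (CayleyFlow.step c k₀) M₀ 0 =
      CayleyFlow.objective Csig M₀ := by
    simp [CayleyFlow.meanObj, CayleyFlow.traj, CayleyFlow.iterate]
  have hf0 := CayleyFlow.objective_nonneg Csig M₀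
  -- `S` is left free: it becomes `σu²` for the rates and the moment bound `(32 ‖C_e‖₂² + 8 r²) v`
  -- for the last estimate.
  have hrec : ∀ S : ℝ, (∀ k, ∫ ω, CayleyFlow.frobSq
        (CayleyFlow.input Csig σ E (CayleyFlow.step c k₀) M₀ k ω) ∂μ ≤ S) → ∀ k : ℕ,
      CayleyFlow.meanObj μ Csig σ E (CayleyFlow.step c k₀) M₀ (k + 1) ≤
        (1 - 2 * c * δ ^ 2 * (1 - c * CayleyFlow.lipConst Csig / (4 * (k + k₀))) / (k + k₀)) *
          CayleyFlow.meanObj μ Csig σ E (CayleyFlow.step c k₀) M₀ k +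
        (2 * c * δ ^ 2 - 1) * CayleyFlow.noiseConst Csig δ c S / (4 * (k + k₀) ^ 2) := by
    intro S hS k
    have hkn : (0 : ℝ) ≤ k := Nat.cast_nonneg k
    have hκ : 0 < (k : ℝ) + k₀ := by positivity
    have h := CayleyFlow.meanObj_succ_le (μ := μ) (η := CayleyFlow.step c k₀) hCsig hEsymm hM₀ hEm
      σ hδ (k := k) (by rw [CayleyFlow.step]; positivity) ?_ (hstay.mono fun ω h => h k) (hUint k)
      (hUmean k) (hS k)
    · refine h.trans_eq ?_
      have hβ1 : 2 * c * δ ^ 2 - 1 ≠ 0 := by linarith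
      have hN : (2 * c * δ ^ 2 - 1) * CayleyFlow.noiseConst Csig δ c S =
          c ^ 2 * CayleyFlow.lipConst Csig * S := by
        rw [CayleyFlow.noiseConst, mul_div_cancel₀ _ hβ1]
      rw [hN, CayleyFlow.step]
      field_simp
    · rw [CayleyFlow.step, mul_div_assoc', div_le_iff₀ hκ]
      linarith
  have hvar : ∀ k, ∫ ω, CayleyFlow.frobSq
      (CayleyFlow.input Csig σ E (CayleyFlow.step c k₀) M₀ k ω) ∂μ ≤ σu ^ 2 := fun k =>
    CayleyFlow.integral_le_of_condExp_le (ℱ.le k) (hUvar k)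
  have hsmall : ∀ S : ℝ, 0 < S → (∀ k, ∫ ω, CayleyFlow.frobSq
        (CayleyFlow.input Csig σ E (CayleyFlow.step c k₀) M₀ k ω) ∂μ ≤ S) →
      ∃ ε₀ : ℝ, 0 < ε₀ ∧ ∀ ε : ℝ, 0 < ε → ε < ε₀ →
        CayleyFlow.sampleCount (CayleyFlow.meanObj μ Csig σ E (CayleyFlow.step c k₀) M₀) ε ≤
          (⌈CayleyFlow.noiseConst Csig δ c S / ε⌉₊ : ℕ∞) := by
    intro S hS hSv
    have hNpos : 0 < CayleyFlow.noiseConst Csig δ c S :=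
      div_pos (by positivity) (by linarith)
    exact CayleyFlow.exists_sampleCount_le_ceil hk₀ hNpos
      (CayleyFlow.eventually_rate hβ hβℓ hℓ hNpos (hrec S hSv))
  have hrate : ∀ k : ℕ, CayleyFlow.meanObj μ Csig σ E (CayleyFlow.step c k₀) M₀ k ≤
      max (2 * k₀ * CayleyFlow.objective Csig M₀) (CayleyFlow.noiseConst Csig δ c (σu ^ 2))
        / ((k : ℝ) + k₀) :=
    CayleyFlow.rate_of_recursion hβ hβℓ hℓ (le_max_of_le_left (by positivity)) (le_max_right _ _)
      (by rw [h0]; exact le_max_left _ _) (by rw [h0]; exact hf0) (hrec _ hvar)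
  refine ⟨fun k => ⟨hf k, hrate k⟩, fun hcond => ?_, fun ε hε => ?_, fun hσu => ?_,
    fun v r hv hE4 hE2c hE4c => ?_, fun σ' k ω => ?_⟩
  · refine CayleyFlow.rate_of_recursion_of_le hβ hβℓ hℓ (le_max_of_le_left (by positivity))
      (le_max_right _ _) (by rw [h0]; exact le_max_left _ _) ?_ (hrec _ hvar)
    have e : 2 / (2 * c * δ ^ 2) = 1 / (c * δ ^ 2) := by field_simp
    rw [e, mul_div_right_comm]
    exact hcond
  · exact CayleyFlow.sampleCount_le_ceil hk₀ hε fun k _ => hrate k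
  · obtain ⟨ε₀, hε₀, h⟩ := hsmall (σu ^ 2) (by positivity) hvar
    refine ⟨ε₀, hε₀, fun ε hε hlt => ?_⟩
    have e : CayleyFlow.stepFactor δ c * (CayleyFlow.lipConst Csig * σu ^ 2 / (δ ^ 2 * ε)) =
        CayleyFlow.noiseConst Csig δ c (σu ^ 2) / ε := by
      have hβ1 : 2 * c * δ ^ 2 - 1 ≠ 0 := by linarith
      rw [CayleyFlow.stepFactor, CayleyFlow.noiseConst]
      field_simp
    rw [e]
    exact h ε hε hlt
  · have hsq : 0 < CayleyFlow.specNorm (CayleyFlow.tf Csig) ^ 2 := by linarith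
    have hEi : ∀ k, Integrable (fun ω => CayleyFlow.frobSq (CayleyFlow.tf (E k ω))) μ := fun k => by
      refine ((integrable_const (1 : ℝ)).add (hE4 k)).mono'
        ((hEm k).mono (ℱ.le _)).tf.frobSq.aestronglyMeasurable
        (Filter.Eventually.of_forall fun ω => ?_)
      simp only [Pi.add_apply]
      rw [Real.norm_of_nonneg (CayleyFlow.frobSq_nonneg _)]
      nlinarith [sq_nonneg (CayleyFlow.frobSq (CayleyFlow.tf (E k ω)) - 1)]
    have hSv : ∀ k, ∫ ω, CayleyFlow.frobSq
        (CayleyFlow.input Csig σ E (CayleyFlow.step c k₀) M₀ k ω) ∂μ ≤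
        (32 * CayleyFlow.specNorm (CayleyFlow.tf Csig) ^ 2 + 8 * r ^ 2) * v := fun k => by
      have h2 := CayleyFlow.integral_le_of_condExp_le (ℱ.le k) (hE2c k)
      have h4 := CayleyFlow.integral_le_of_condExp_le (ℱ.le k) (hE4c k)
      have hm := integral_mono (hUint k)
        (((hEi k).const_mul (32 * CayleyFlow.specNorm (CayleyFlow.tf Csig) ^ 2)).add
          ((hE4 k).const_mul 8))
        (fun ω => CayleyFlow.frobSq_input_le (η := CayleyFlow.step c k₀) hCsig hEsymm hM₀ σ k ω)
      simp only [Pi.add_apply] at hm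
      rw [integral_add ((hEi k).const_mul _) ((hE4 k).const_mul _), integral_const_mul,
        integral_const_mul] at hm
      nlinarith
    obtain ⟨ε₀, hε₀, h⟩ := hsmall _ (by positivity) hSv
    refine ⟨ε₀, hε₀, fun ε hε hlt => ?_⟩
    have e : CayleyFlow.dimConst n * CayleyFlow.stepFactor δ c *
          (32 * CayleyFlow.specNorm (CayleyFlow.tf Csig) ^ 2 + 8 * r ^ 2) *
          (CayleyFlow.specNorm (CayleyFlow.tf Csig) ^ 2 * v / (δ ^ 2 * ε)) =
        CayleyFlow.noiseConst Csig δ c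
          ((32 * CayleyFlow.specNorm (CayleyFlow.tf Csig) ^ 2 + 8 * r ^ 2) * v) / ε := by
      have hβ1 : 2 * c * δ ^ 2 - 1 ≠ 0 := by linarith
      rw [CayleyFlow.stepFactor, CayleyFlow.noiseConst, CayleyFlow.lipConst]
      field_simp
    rw [e]
    exact h ε hε hlt
  · exact CayleyFlow.traj_background_free hCsig hEsymm hM₀ σ σ' k ω
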